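/- **Theorem 3.2.** Let $A_1,A_2,\dots$ be i.i.d. centered Gaussian processes indexed by $\mathbb R$ with continuous sample paths, stationary increments and $A_i(0)=0$; let $v$ be their variance function, $\operatorname{Var}(A_i(t)-A_i(s))=v(t-s)$ for $s\le t$, and assume that $\lim_{t\to\infty}v(t)/t^{\alpha}=0$ for some $\alpha<2$. Let $b>0$ and $c_1>c_2>0$. For $n\ge1$ let $n$ such sources feed a two-node tandem queue with infinite buffers, operating since time $-\infty$: $\sum_{i=1}^n(A_i(t)-A_i(s))$ is the traffic offered in $(s,t]$ to the first queue, which has service rate $nc_1$, and the output of the first queue is the input of the second queue, which has service rate $nc_2$. (The content at time $\tau$ of a queue with cumulative input $x$ and service rate $c$ is $\sup_{u<\tau}\big(x(\tau)-x(u)-c(\tau-u)\big)$; its output in $(u,\tau]$ is the input in $(u,\tau]$ minus the increase of the content.) Let $Q_{2,n}$ be the stationary content of the second queue, i.e. its content at time $0$. Let $\Omega$ be the set of continuous $f:\mathbb R\to\mathbb R$ with $f(0)=0$ and $f(t)/(1+|t|)\to0$ as $t\to\pm\infty$. Let $\Gamma(s,t)=\tfrac12\big(v(|t|)-v(|t-s|)+v(|s|)\big)$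 be the covariance function of $A_i$, let $R$ be the reproducing kernel Hilbert space of $\Gamma$ (the completion, as a space of functions, of the span of the functions $\Gamma(s,\cdot)$, $s\in\mathbb R$, under $\langle\Gamma(s,\cdot),\Gamma(t,\cdot)\rangle_R=\Gamma(s,t)$), and put $I(f)=\tfrac12\|f\|_R^2$ if $f\in R$ and $I(f)=\infty$ otherwise. Let $t_0=b/(c_1-c_2)$ and $$\mathcal U^{s,t}=\{f\in\Omega:\ -f(-t)\ge b+c_2t,\ \ f(-s)-f(-t)\ge b+c_2t-c_1s\}.$$ Then the decay rate $J:=-\lim_{n\to\infty}\frac1n\log\mathbb P(Q_{2,n}>nb)$ exists in $[0,\infty]$ (with $\log 0=-\infty$), and $$J\ \ge\ \inf_{t>t_0}\ \sup_{s\in(0,t)}\ \inf_{f\in\mathcal U^{s,t}} I(f),$$ where the infimum over an empty set is $\infty$. -/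

import Mathlib

open MeasureTheory ProbabilityTheory Filter Set Topology

namespace TandemQueue

noncomputable section

/-- The covariance function `Γ(s, t) = (v(|t|) - v(|t - s|) + v(|s|)) / 2` on `ℝ × ℝ` that belongs
to a variance function `v` on `[0, ∞)`. -/
def covariance (v : ℝ → ℝ) (s t : ℝ) : ℝ := (v |t| - v |t - s| + v |s|) / 2

/-- A (single) Gaussian source with variance function `v`: a centered Gaussian process indexed by
`ℝ`, null at time `0`, with continuous sample paths and stationary increments, such that
`Var (X t - X s) = v (t - s)`. The traffic generated in `(s, t]` is `X t - X s`. -/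
structure IsGaussianSource {Ω : Type*} [MeasurableSpace Ω] (v : ℝ → ℝ) (X : ℝ → Ω → ℝ)
    (P : Measure Ω) : Prop where
  measurable : ∀ t, Measurable (X t)
  gaussian : IsGaussianProcess X P
  centered : ∀ t, ∫ ω, X t ω ∂P = 0
  zero : ∀ ω, X 0 ω = 0
  continuous_paths : ∀ ω, Continuous fun t ↦ X t ω
  stationary_increments : ∀ h, IdentDistrib (fun ω t ↦ X (t + h) ω - X h ω) (fun ω t ↦ X t ω) P P
  variance_increment : ∀ s t, s ≤ t → Var[fun ω ↦ X t ω - X s ω; P] = v (t - s)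

/-- The covariance function as a kernel, in the (operator-valued) form Mathlib uses. -/
def covKernel (v : ℝ → ℝ) : Matrix ℝ ℝ (ℝ →L[ℝ] ℝ) :=
  Matrix.of fun s t ↦ covariance v s t • 1

/-- For a source with variance function `v`, `covariance v` is indeed its covariance. -/
theorem IsGaussianSource.cov_eq {Ω : Type*} [MeasurableSpace Ω] {P : Measure Ω}
    [IsProbabilityMeasure P] {v : ℝ → ℝ} {X : ℝ → Ω → ℝ} (hX : IsGaussianSource v X P)
    (s t : ℝ) : cov[X s, X t; P] = covariance v s t := by
  have hm : ∀ t, MemLp (X t) 2 P := fun t ↦ (hX.gaussian.hasGaussianLaw_eval t).memLp_two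
  have h0 : X 0 = fun _ ↦ (0 : ℝ) := funext hX.zero
  have hvar : ∀ s t, s ≤ t → Var[X t; P] - 2 * cov[X t, X s; P] + Var[X s; P] = v (t - s) := by
    intro s t hst
    rw [← hX.variance_increment s t hst, variance_fun_sub (hm t) (hm s)]
  have habs : ∀ t, Var[X t; P] = v |t| := by
    intro t
    rcases le_total 0 t with h | h
    · have := hX.variance_increment 0 t h
      simpa [h0, abs_of_nonneg h] using this
    · have := hX.variance_increment t 0 h
      simpa [h0, abs_of_nonpos h, variance_fun_neg] using this
  unfold covariance
  rw [← habs s, ← habs t]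
  rcases le_total s t with h | h
  · have := hvar s t h
    rw [abs_of_nonneg (sub_nonneg.2 h), ← this, covariance_comm (X s)]
    ring
  · have := hvar t s h
    rw [abs_of_nonpos (sub_nonpos.2 h), neg_sub, ← this]
    ring

/-- The covariance kernel of a source is positive semidefinite. -/
theorem IsGaussianSource.posSemidef {Ω : Type*} [MeasurableSpace Ω] {P : Measure Ω}
    [IsProbabilityMeasure P] {v : ℝ → ℝ} {X : ℝ → Ω → ℝ} (hX : IsGaussianSource v X P) :
    (covKernel v).PosSemidef := by
  have hm : ∀ t, MemLp (X t) 2 P := fun t ↦ (hX.gaussian.hasGaussianLaw_eval t).memLp_two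
  have hcomm : ∀ s t, covariance v s t = covariance v t s := fun s t ↦ by
    rw [← hX.cov_eq, ← hX.cov_eq, covariance_comm]
  have htfae := (RKHS.posSemidef_tfae (K := covKernel v)).out 0 2
  refine htfae.2 ⟨?_, fun a ↦ ?_⟩
  · ext s t
    simp [covKernel, hcomm s t, Matrix.conjTranspose_apply]
  · have h : 0 ≤ Var[fun ω ↦ ∑ s ∈ a.support, a s * X s ω; P] := variance_nonneg _ _
    rw [variance_fun_sum' fun s _ ↦ (hm s).const_mul (a s)] at h
    refine h.trans_eq ?_
    simp only [covariance_const_mul_left, covariance_const_mul_right, hX.cov_eq, Finsupp.sum,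
      covKernel]
    simp only [RCLike.re_to_real]
    refine Finset.sum_congr rfl fun s _ ↦ Finset.sum_congr rfl fun t _ ↦ ?_
    simp only [hcomm t s, Matrix.of_apply, smul_apply, smul_eq_mul,
      one_apply_eq_self, RCLike.inner_apply, conj_trivial]
    ring

/-- The rate function `I` belonging to a positive semidefinite kernel `K` on `ℝ`:
`I f = ‖f‖² / 2` if `f` belongs to the reproducing kernel Hilbert space `R` of `K`, and `I f = ∞`
otherwise. Mathlib's `RKHS.OfKernel K` is the completion of the finite combinations
`∑ aᵢ K(sᵢ, ·)` under `⟪∑ aᵢ K(sᵢ, ·), ∑ bⱼ K(sⱼ, ·)⟫ = ∑ aᵢ bⱼ K(sᵢ, sⱼ)`, embedded into the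
functions on `ℝ`; at most one of its elements `g` is equal to `f` as a function. -/
def rateFunction (K : Matrix ℝ ℝ (ℝ →L[ℝ] ℝ)) (hK : K.PosSemidef) (f : ℝ → ℝ) : EReal :=
  haveI : Fact K.PosSemidef := ⟨hK⟩
  ⨅ (g : RKHS.OfKernel K) (_ : (g : ℝ → ℝ) = f), ((‖g‖ ^ 2 / 2 : ℝ) : EReal)

/-- The path space: continuous functions, null at `0`, with `ω t / (1 + |t|) → 0` at `±∞`. -/
def pathSpace : Set (ℝ → ℝ) :=
  {w | Continuous w ∧ w 0 = 0 ∧ Tendsto (fun t ↦ w t / (1 + |t|)) atTop (𝓝 0) ∧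
    Tendsto (fun t ↦ w t / (1 + |t|)) atBot (𝓝 0)}

/-- The set `U^{s,t}` of paths `f` with `-f(-t) ≥ b + c₂ t` and
`f(-s) - f(-t) ≥ b + c₂ t - c₁ s`. -/
def pathsU (b c₁ c₂ s t : ℝ) : Set (ℝ → ℝ) :=
  {f ∈ pathSpace | -f (-t) ≥ b + c₂ * t ∧ f (-s) - f (-t) ≥ b + c₂ * t - c₁ * s}

/-- Content at time `τ` of an infinite buffer that has been operating since time `-∞`, with
cumulative input `x` (the input in `(u, τ]` is `x τ - x u`) and constant service rate `c`:
`sup_{u < τ} (x τ - x u - c (τ - u))`. -/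
def bufferContent (x : ℝ → ℝ) (c τ : ℝ) : ℝ := ⨆ u : Iio τ, (x τ - x u - c * (τ - u))

/-- Cumulative output of that buffer: in `(u, τ]` the traffic leaving it is the input in `(u, τ]`
minus the increase of the buffer content. -/
def bufferOutput (x : ℝ → ℝ) (c τ : ℝ) : ℝ := x τ - bufferContent x c τ

/-- Content at time `τ` of the second queue of the tandem: its input is the output of the first
queue. The service rates are `c₁` and `c₂`. -/
def secondQueue (x : ℝ → ℝ) (c₁ c₂ τ : ℝ) : ℝ := bufferContent (bufferOutput x c₁) c₂ τ

end

end TandemQueue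

/-! Seen backwards from time 0, the content of the second queue exceeds `b` exactly when, for some
`u < 0`, the input path `f` satisfies `f w - f u > b - c₂ u + c₁ w` for all `w ∈ [u, 0]`
(`exists_overflowFrom_of_lt_secondQueue`, `lt_secondQueue_of_overflowFrom`). The decay rate is the
infimum of `‖f‖² / 2` over the paths `f` of the reproducing kernel Hilbert space that overflow in
this sense (`decayRate`). The inequality then follows: if `f` overflows from `u`, the constraint at
`w = u` gives `t = -u > t₀`, and those at `w = 0` and `w = -s` put the same `f` into `U^{s,t}` for
every `s ∈ (0, t)`.

The existence of the limit rests on finite-dimensional Gaussian estimates for the normalised sum `Y`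
of `n` sources, which has the law of a single source; its constants must depend on `v` only.

Upper bound (`measure_overflow_le`): starts in the far past are negligible (`exists_tail`),
oscillations inside the cells of a fine grid are negligible by Fernique's inequality, and what
remains is a finite union of closed convex events, each inside a half-space
(`measure_mem_convex_le`). The grid loses a small `ε` in the level; by weak compactness of balls
this hardly changes the minimal norm (`exists_gap`).

Lower bound (`le_measure_overflow`): replace an overflowing `f` by a finite combination `g = ∑ aᵢ
kᵢ`. With `Z = ∑ aᵢ Yᵢ`, the process `Y` is `Z g / ‖g‖²` plus a residual independent of `Z`. If `Z`
is close to `√n ‖g‖²`, at exponential cost `n ‖g‖² / 2`, and the residual is small, `Y` follows `√n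
g` and overflows. -/

namespace TandemQueue

/-! ### Overflowing paths, regular variances and feature maps. -/

/-- The path `f`, seen backwards from time `0`, overfills the second queue with a busy period that
starts at time `u`. -/
def OverflowFrom (b c₁ c₂ u : ℝ) (f : ℝ → ℝ) : Prop :=
  ∀ w ∈ Icc u 0, b - c₂ * u + c₁ * w < f w - f u

/-- The version of `OverflowFrom` with weak inequalities. -/
def WeakOverflowFrom (b c₁ c₂ u : ℝ) (f : ℝ → ℝ) : Prop :=
  ∀ w ∈ Icc u 0, b - c₂ * u + c₁ * w ≤ f w - f u

/-- The regularity of a variance function on which the analysis of the tandem queue depends. -/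
structure IsRegularVariance (v : ℝ → ℝ) : Prop where
  zero : v 0 = 0
  cont : Tendsto (fun r ↦ v |r|) (𝓝 0) (𝓝 0)
  growth : ∃ β : ℝ, 0 ≤ β ∧ β < 2 ∧ ∀ᶠ t in atTop, v t ≤ t ^ β

/-- A feature map of the covariance function of `v` whose values span a dense subspace. -/
structure IsFeatureMap {H : Type*} [NormedAddCommGroup H] [InnerProductSpace ℝ H] (v : ℝ → ℝ)
    (k : ℝ → H) : Prop where
  inner_eq : ∀ s t, inner ℝ (k s) (k t) = covariance v s t
  dense : (Submodule.span ℝ (range k)).topologicalClosure = ⊤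

/-- Subquadratic growth makes `|⟨k t, f⟩| ≤ ‖f‖ √v(|t|)` of smaller order than `|t|`: the source of
all control at infinity. -/
theorem IsRegularVariance.eventually_mul_lt {v : ℝ → ℝ} (hv : IsRegularVariance v) {M c : ℝ}
    (hM : 0 ≤ M) (hc : 0 < c) : ∀ᶠ t in atTop, M * v t < c * t ^ 2 := by
  obtain ⟨β, hβ0, hβ, hg⟩ := hv.growth
  have h0 : Tendsto (fun t : ℝ ↦ M * t ^ (-(2 - β))) atTop (𝓝 (M * 0)) :=
    (tendsto_rpow_neg_atTop (by linarith)).const_mul _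
  rw [mul_zero] at h0
  filter_upwards [hg, h0.eventually_lt_const hc, eventually_gt_atTop 0] with t h1 h2 ht
  calc M * v t ≤ M * t ^ β := by gcongr
    _ = M * t ^ (-(2 - β)) * t ^ (2 : ℝ) := by
        rw [mul_assoc, ← Real.rpow_add ht]; ring_nf
    _ = M * t ^ (-(2 - β)) * t ^ 2 := by norm_cast
    _ < c * t ^ 2 := by gcongr

theorem norm_linearCombination_sq {H : Type*} [NormedAddCommGroup H] [InnerProductSpace ℝ H]
    (k : ℝ → H) (a : ℝ →₀ ℝ) : ‖Finsupp.linearCombination ℝ k a‖ ^ 2 =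
      ∑ s ∈ a.support, ∑ t ∈ a.support, a s * a t * inner ℝ (k s) (k t) := by
  rw [← real_inner_self_eq_norm_sq]
  simp only [Finsupp.linearCombination_apply, Finsupp.sum, sum_inner, inner_sum,
    inner_smul_left, inner_smul_right, conj_trivial]
  refine Finset.sum_congr rfl fun s _ ↦ ?_
  rw [Finset.mul_sum]
  refine Finset.sum_congr rfl fun t _ ↦ ?_
  rw [real_inner_comm (k t)]
  ring

/-! ### Minimal norm of overflowing paths: stability under small changes of the level. -/

section Hilbert

variable {H : Type*} [NormedAddCommGroup H] [InnerProductSpace ℝ H] {v : ℝ → ℝ} {k : ℝ → H}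

namespace IsFeatureMap

theorem norm_sub_sq (hk : IsFeatureMap v k) (hv : IsRegularVariance v) (s t : ℝ) :
    ‖k s - k t‖ ^ 2 = v |s - t| := by
  rw [norm_sub_sq_real, ← real_inner_self_eq_norm_sq, ← real_inner_self_eq_norm_sq, hk.inner_eq,
    hk.inner_eq, hk.inner_eq]
  simp only [covariance, sub_self, abs_zero, hv.zero, abs_sub_comm t s]
  ring

theorem zero (hk : IsFeatureMap v k) (hv : IsRegularVariance v) : k 0 = 0 := by
  have h : ‖k 0‖ ^ 2 = 0 := by
    rw [← real_inner_self_eq_norm_sq, hk.inner_eq]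
    simp [covariance, hv.zero]
  simpa using h

theorem norm_sq (hk : IsFeatureMap v k) (hv : IsRegularVariance v) (t : ℝ) :
    ‖k t‖ ^ 2 = v |t| := by
  simpa [hk.zero hv] using hk.norm_sub_sq hv t 0

theorem continuous (hk : IsFeatureMap v k) (hv : IsRegularVariance v) : Continuous k := by
  refine continuous_iff_continuousAt.2 fun t ↦ ?_
  rw [ContinuousAt, tendsto_iff_norm_sub_tendsto_zero]
  have h : Tendsto (fun s ↦ √(v |s - t|)) (𝓝 t) (𝓝 0) := by
    have h1 : Tendsto (fun s ↦ s - t) (𝓝 t) (𝓝 0) := by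
      have : Tendsto (fun s : ℝ ↦ s - t) (𝓝 t) (𝓝 (t - t)) :=
        (continuous_id.sub continuous_const).tendsto t
      simpa using this
    have h2 := (Real.continuous_sqrt.tendsto 0).comp (hv.cont.comp h1)
    rwa [Real.sqrt_zero] at h2
  refine h.congr fun s ↦ ?_
  rw [← hk.norm_sub_sq hv, Real.sqrt_sq (norm_nonneg _)]

/-- Membership criterion for the Hilbert space: the functional `∑ aₜ k t ↦ ∑ aₜ f t` is bounded on a
dense subspace, so it extends, and Riesz represents it. -/
theorem exists_of_bounded [CompleteSpace H] (hk : IsFeatureMap v k) (f : ℝ → ℝ) {C : ℝ}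
    (hC : 0 ≤ C)
    (hf : ∀ a : ℝ →₀ ℝ,
      |Finsupp.linearCombination ℝ f a| ≤ C * ‖Finsupp.linearCombination ℝ k a‖) :
    ∃ g : H, (∀ t, inner ℝ (k t) g = f t) ∧ ‖g‖ ≤ C := by
  have hd : DenseRange (Finsupp.linearCombination ℝ k) := by
    have h := hk.dense
    rw [← Finsupp.range_linearCombination] at h
    rw [DenseRange, ← LinearMap.coe_range]
    exact Submodule.dense_iff_topologicalClosure_eq_top.2 h
  let φ : H →L[ℝ] ℝ := (Finsupp.linearCombination ℝ f).extendOfNorm (Finsupp.linearCombination ℝ k)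
  have hφ (a) : φ (Finsupp.linearCombination ℝ k a) = Finsupp.linearCombination ℝ f a :=
    LinearMap.extendOfNorm_eq hd ⟨C, hf⟩ a
  refine ⟨(InnerProductSpace.toDual ℝ H).symm φ, fun t ↦ ?_, ?_⟩
  · rw [real_inner_comm, InnerProductSpace.toDual_symm_apply]
    simpa using hφ (Finsupp.single t 1)
  · rw [LinearIsometryEquiv.norm_map]
    exact φ.opNorm_le_bound hC fun x ↦ LinearMap.norm_extendOfNorm_apply_le hd C hf x

/-- By stationarity of increments, `k (t + θ) - k θ` has the same Gram matrix as `k t`, so shifting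
a path in time and recentring it does not increase its norm. -/
theorem exists_shift [CompleteSpace H] (hk : IsFeatureMap v k) (hv : IsRegularVariance v) (f : H)
    (θ : ℝ) : ∃ g : H, (∀ t, inner ℝ (k t) g = inner ℝ (k (t + θ)) f - inner ℝ (k θ) f) ∧
      ‖g‖ ≤ ‖f‖ := by
  refine hk.exists_of_bounded _ (norm_nonneg f) fun a ↦ ?_
  have h1 : Finsupp.linearCombination ℝ (fun t ↦ inner ℝ (k (t + θ)) f - inner ℝ (k θ) f) a =
      inner ℝ (Finsupp.linearCombination ℝ (fun t ↦ k (t + θ) - k θ) a) f := by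
    simp [Finsupp.linearCombination_apply, Finsupp.sum, sum_inner, inner_smul_left,
      inner_sub_left]
  have h2 : ‖Finsupp.linearCombination ℝ (fun t ↦ k (t + θ) - k θ) a‖ =
      ‖Finsupp.linearCombination ℝ k a‖ := by
    rw [← sq_eq_sq₀ (norm_nonneg _) (norm_nonneg _), norm_linearCombination_sq,
      norm_linearCombination_sq]
    refine Finset.sum_congr rfl fun s _ ↦ Finset.sum_congr rfl fun t _ ↦ ?_
    have : t + θ - (s + θ) = t - s := by ring
    simp only [inner_sub_left, inner_sub_right, hk.inner_eq, covariance, this, sub_self, abs_zero,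
      hv.zero, add_sub_cancel_right, sub_add_cancel_right, abs_neg]
    ring
  rw [h1, ← h2, mul_comm]
  exact abs_real_inner_le_norm _ _

/-- Bounded elements are equicontinuous as paths because `k` is norm continuous; hence convergence
at the fixed point `y` transfers to moving points. -/
theorem tendsto_inner (hk : IsFeatureMap v k) (hv : IsRegularVariance v) {ι : Type*}
    {l : Filter ι} {f : ι → H} {M : ℝ} (hM : ∀ i, ‖f i‖ ≤ M) {x : ι → ℝ} {y z : ℝ}
    (hx : Tendsto x l (𝓝 y)) (hf : Tendsto (fun i ↦ inner ℝ (k y) (f i)) l (𝓝 z)) :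
    Tendsto (fun i ↦ inner ℝ (k (x i)) (f i)) l (𝓝 z) := by
  have h0 : Tendsto (fun i ↦ inner ℝ (k (x i) - k y) (f i)) l (𝓝 0) := by
    have h1 : Tendsto (fun i ↦ ‖k (x i) - k y‖ * M) l (𝓝 (0 * M)) := by
      refine Tendsto.mul_const _ ?_
      exact tendsto_iff_norm_sub_tendsto_zero.1 (((hk.continuous hv).tendsto y).comp hx)
    rw [zero_mul] at h1
    refine squeeze_zero_norm (fun i ↦ ?_) h1
    exact (norm_inner_le_norm _ _).trans (by gcongr; exact hM i)
  simpa [inner_sub_left] using h0.add hf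

/-- Weak compactness of the ball, carried out with pointwise limits along an ultrafilter. The
starting times stay bounded: the constraint at `w = 0` forces `-f u ≥ c₂ |u|`, whereas `|f u| ≤ M
√v(|u|)`. -/
theorem exists_weakOverflow_limit [CompleteSpace H] (hk : IsFeatureMap v k)
    (hv : IsRegularVariance v) {b c₁ c₂ M : ℝ} (hb : 0 < b) (hc₂ : 0 < c₂) (hM : 0 ≤ M)
    (h : ∀ ε > 0, ∃ f : H, ‖f‖ ≤ M ∧ ∃ u ≤ 0,
      WeakOverflowFrom (b - ε) c₁ c₂ u fun t ↦ inner ℝ (k t) f) :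
    ∃ f : H, ‖f‖ ≤ M ∧ ∃ u ≤ 0, WeakOverflowFrom b c₁ c₂ u fun t ↦ inner ℝ (k t) f := by
  have h' : ∀ n : ℕ, ∃ (f : H) (u : ℝ), ‖f‖ ≤ M ∧ u ≤ 0 ∧
      WeakOverflowFrom (b - b / (n + 1)) c₁ c₂ u fun t ↦ inner ℝ (k t) f := fun n ↦ by
    obtain ⟨f, hf, u, hu, hfu⟩ := h (b / (n + 1)) (by positivity)
    exact ⟨f, u, hf, hu, hfu⟩
  choose f u hf hu hfu using h'
  obtain ⟨T, hT⟩ := eventually_atTop.1 (hv.eventually_mul_lt (M := M ^ 2) (c := c₂ ^ 2) (by positivity) (by positivity))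
  have hinner (n t) : |inner ℝ (k t) (f n)| ≤ ‖k t‖ * M :=
    (abs_real_inner_le_norm _ _).trans (by gcongr; exact hf n)
  have huT (n) : u n ∈ Icc (-T) 0 := by
    refine ⟨?_, hu n⟩
    by_contra! hlt
    have h1 := hfu n 0 ⟨hu n, le_rfl⟩
    have h2 := hT (-u n) (by linarith)
    have h3 := hinner n (u n)
    have h4 : 0 ≤ b - b / (n + 1) := by
      rw [sub_nonneg]
      exact div_le_self hb.le (by linarith [n.cast_nonneg (α := ℝ)])
    have h5 := hk.norm_sq hv (u n)
    rw [abs_of_nonpos (hu n)] at h5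
    simp only [hk.zero hv, inner_zero_left, mul_zero, add_zero, zero_sub] at h1
    have h6 : c₂ * (-u n) ≤ ‖k (u n)‖ * M := by
      have := neg_le_abs (inner ℝ (k (u n)) (f n))
      linarith
    have h7 : (c₂ * (-u n)) ^ 2 ≤ (‖k (u n)‖ * M) ^ 2 :=
      pow_le_pow_left₀ (mul_nonneg hc₂.le (by linarith [hu n])) h6 2
    rw [mul_pow, mul_pow, h5] at h7
    linarith
  have hlim (t) : ∃ y, Tendsto (fun n ↦ inner ℝ (k t) (f n)) (hyperfilter ℕ) (𝓝 y) := by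
    obtain ⟨y, -, hy⟩ := (isCompact_Icc (a := -(‖k t‖ * M)) (b := ‖k t‖ * M)).ultrafilter_le_nhds
      ((hyperfilter ℕ).map fun n ↦ inner ℝ (k t) (f n))
      (le_principal_iff.2 (mem_map.2 (univ_mem' fun n ↦ abs_le.1 (hinner n t))))
    exact ⟨y, hy⟩
  choose φ hφ using hlim
  obtain ⟨u₀, hu₀, hulim⟩ := (isCompact_Icc (a := -T) (b := (0 : ℝ))).ultrafilter_le_nhds
    ((hyperfilter ℕ).map u) (le_principal_iff.2 (mem_map.2 (univ_mem' huT)))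
  replace hulim : Tendsto u (hyperfilter ℕ) (𝓝 u₀) := hulim
  obtain ⟨g, hg, hgM⟩ := hk.exists_of_bounded φ hM fun a ↦ by
    have h1 : Tendsto (fun n ↦ |inner ℝ (Finsupp.linearCombination ℝ k a) (f n)|) (hyperfilter ℕ)
        (𝓝 |Finsupp.linearCombination ℝ φ a|) := by
      refine Tendsto.abs ?_
      simp only [Finsupp.linearCombination_apply, Finsupp.sum, sum_inner, inner_smul_left,
        conj_trivial, smul_eq_mul]
      exact tendsto_finsetSum _ fun t _ ↦ (hφ t).const_mul _
    refine le_of_tendsto h1 (Eventually.of_forall fun n ↦ ?_)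
    rw [mul_comm]
    exact (abs_real_inner_le_norm _ _).trans (by gcongr; exact hf n)
  refine ⟨g, hgM, u₀, hu₀.2, fun w hw ↦ ?_⟩
  simp only [hg]
  -- A point `w` of the limit interval may lie left of `u n`; `max w (u n)` is admissible for every
  -- `n` and still tends to `w`.
  have hmax : Tendsto (fun n ↦ max w (u n)) (hyperfilter ℕ) (𝓝 w) := by
    simpa [max_eq_left hw.1] using (tendsto_const_nhds (x := w)).max hulim
  have hb' : Tendsto (fun n : ℕ ↦ b - b / ((n : ℝ) + 1)) (hyperfilter ℕ) (𝓝 b) := by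
    have : Tendsto (fun n : ℕ ↦ b - b * (1 / ((n : ℝ) + 1))) atTop (𝓝 (b - b * 0)) :=
      tendsto_const_nhds.sub (tendsto_one_div_add_atTop_nhds_zero_nat.const_mul b)
    simp only [mul_zero, sub_zero, mul_one_div] at this
    exact this.mono_left Nat.hyperfilter_le_atTop
  refine le_of_tendsto_of_tendsto
    ((hb'.sub (hulim.const_mul c₂)).add (hmax.const_mul c₁))
    ((hk.tendsto_inner hv hf hmax (hφ w)).sub (hk.tendsto_inner hv hf hulim (hφ u₀)))
    (Eventually.of_forall fun n ↦ ?_)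
  exact hfu n _ ⟨le_max_right _ _, max_le hw.2 (hu n)⟩

/-- Move the start to the minimiser `u'` of `F t - c₂ t`, so that later increments of `F` are
positive and multiplication by `r > 1` makes the constraints strict. Only `w = u'`, where the
increment vanishes, escapes this; there strictness means `b < -(c₁ - c₂) u'`. -/
theorem exists_overflow_of_weakOverflow [CompleteSpace H] (hk : IsFeatureMap v k)
    (hv : IsRegularVariance v) {b c₁ c₂ : ℝ} (hb : 0 < b) (hc₂ : 0 < c₂) (hc : c₂ < c₁)
    {f : H} {u : ℝ} (hu : u ≤ 0) (hf : WeakOverflowFrom b c₁ c₂ u fun t ↦ inner ℝ (k t) f)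
    {r : ℝ} (hr : 1 < r) :
    ∃ g : H, ‖g‖ ≤ r * ‖f‖ ∧ ∃ u < 0, OverflowFrom b c₁ c₂ u fun t ↦ inner ℝ (k t) g := by
  have hcont : Continuous fun t ↦ inner ℝ (k t) f := (hk.continuous hv).inner continuous_const
  set F : ℝ → ℝ := fun t ↦ inner ℝ (k t) f with hF
  obtain ⟨u', hu', hmin⟩ := (isCompact_Icc (a := u) (b := (0 : ℝ))).exists_isMinOn
    (nonempty_Icc.2 hu) (f := fun t ↦ F t - c₂ * t) (by fun_prop)
  have hA (w) (hw : w ∈ Icc u' 0) : c₂ * (w - u') ≤ F w - F u' := by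
    have := hmin (show w ∈ Icc u 0 from ⟨hu'.1.trans hw.1, hw.2⟩)
    simp only [mem_ofPred_eq] at this
    linarith
  have hB (w) (hw : w ∈ Icc u' 0) : b - c₂ * u' + c₁ * w ≤ F w - F u' := by
    have h1 := hf w ⟨hu'.1.trans hw.1, hw.2⟩
    have h2 := hmin (show u ∈ Icc u 0 from ⟨le_rfl, hu⟩)
    simp only [mem_ofPred_eq] at h2
    linarith
  have hκ : b ≤ -(c₁ - c₂) * u' := by
    have := hB u' ⟨le_rfl, hu'.2⟩
    linarith
  have hu0 : u' < 0 := by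
    by_contra! h0
    nlinarith
  rcases hκ.lt_or_eq with hlt | heq
  · refine ⟨r • f, by rw [norm_smul, Real.norm_of_nonneg (by linarith)], u', hu0, fun w hw ↦ ?_⟩
    simp only [inner_smul_right]
    change _ < r * F w - r * F u'
    rcases hw.1.eq_or_lt with rfl | hw'
    · linarith
    · have h1 := hA w hw
      have h2 := hB w hw
      have h3 : 0 < c₂ * (w - u') := mul_pos hc₂ (by linarith)
      nlinarith
  -- In the boundary case `b = -(c₁ - c₂) u'` the path is also shifted into the past by `θ / 2`,
  -- which relaxes every constraint by `(c₁ - c₂) θ / 2`. The shift brings in values of `F` on `(0,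
  -- θ / 2]`; there continuity at 0 and the strictness gained from `r` suffice.
  · have h0 : -(c₁ * u') ≤ F 0 - F u' := by
      have := hB 0 ⟨hu0.le, le_rfl⟩
      linarith
    have hlim : ∀ᶠ w in 𝓝 (0 : ℝ), -(c₁ * u') + c₁ * w < r * (F w - F u') := by
      refine ContinuousAt.eventually_lt (by fun_prop) (by fun_prop) ?_
      have : 0 < -(c₁ * u') := by nlinarith
      nlinarith
    obtain ⟨θ, hθ, hball⟩ := Metric.eventually_nhds_iff.1 hlim
    have hθ2 : 0 < θ / 2 := by positivity
    obtain ⟨g, hg, hgn⟩ := hk.exists_shift hv f (θ / 2)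
    refine ⟨r • g, ?_, u' - θ / 2, by linarith, fun w hw ↦ ?_⟩
    · rw [norm_smul, Real.norm_of_nonneg (by linarith)]
      gcongr
    simp only [inner_smul_right, hg, sub_add_cancel]
    change _ < r * (F (w + θ / 2) - F (θ / 2)) - r * (F u' - F (θ / 2))
    have hpos : 0 < (c₁ - c₂) * (θ / 2) := mul_pos (by linarith) hθ2
    rcases le_or_gt (w + θ / 2) 0 with hw0 | hw0
    · have h2 := hB (w + θ / 2) ⟨by linarith [hw.1], hw0⟩
      have h3 : 0 ≤ c₁ * (w + θ / 2 - u') := mul_nonneg (by linarith) (by linarith [hw.1])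
      nlinarith
    · have h4 := hball (y := w + θ / 2) (by
        rw [Real.dist_eq, sub_zero, abs_of_pos hw0]; linarith [hw.2])
      nlinarith

/-- If all overflowing elements have norm at least `√(2 * J)`, then for `L < J` even the almost
overflowing ones have norm at least `√(2 * L)`. -/
theorem exists_gap [CompleteSpace H] (hk : IsFeatureMap v k)
    (hv : IsRegularVariance v) {b c₁ c₂ : ℝ} (hb : 0 < b) (hc₂ : 0 < c₂) (hc : c₂ < c₁) {J L : ℝ}
    (hJ : ∀ f : H, (∃ u < 0, OverflowFrom b c₁ c₂ u fun t ↦ inner ℝ (k t) f) → 2 * J ≤ ‖f‖ ^ 2)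
    (hLJ : L < J) :
    ∃ ε > 0, ∀ f : H, ∀ u ≤ 0, WeakOverflowFrom (b - ε) c₁ c₂ u (fun t ↦ inner ℝ (k t) f) →
      2 * L ≤ ‖f‖ ^ 2 := by
  by_contra! hcon
  have hL : 0 ≤ L := by
    obtain ⟨f, -, -, -, hf⟩ := hcon 1 one_pos
    nlinarith [sq_nonneg ‖f‖]
  obtain ⟨f, hfM, u, hu, hfu⟩ := hk.exists_weakOverflow_limit hv (c₁ := c₁) hb hc₂
    (Real.sqrt_nonneg (2 * L)) fun ε hε ↦ by
      obtain ⟨f, u, hu, hfu, hf⟩ := hcon ε hε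
      exact ⟨f, Real.le_sqrt_of_sq_le hf.le, u, hu, hfu⟩
  have hf2 : ‖f‖ ^ 2 ≤ 2 * L := (Real.le_sqrt (norm_nonneg _) (by positivity)).1 hfM
  -- The weakly overflowing limit has squared norm at most `2 L`; making it strict costs a factor
  -- `r`, and `r ↓ 1` yields `J ≤ L`.
  have hlim : Tendsto (fun r : ℝ ↦ r ^ 2 * ‖f‖ ^ 2) (𝓝[>] 1) (𝓝 (1 ^ 2 * ‖f‖ ^ 2)) :=
    (Continuous.tendsto (by fun_prop) 1).mono_left nhdsWithin_le_nhds
  have := ge_of_tendsto hlim (b := 2 * J) (by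
    filter_upwards [self_mem_nhdsWithin] with r hr
    obtain ⟨g, hg, hgo⟩ := hk.exists_overflow_of_weakOverflow hv hb hc₂ hc hu hfu hr
    calc 2 * J ≤ ‖g‖ ^ 2 := hJ g hgo
      _ ≤ (r * ‖f‖) ^ 2 := by gcongr
      _ = _ := by ring)
  linarith

end IsFeatureMap

end Hilbert

/-! ### Fernique-type tail bounds for maxima of Gaussian processes. -/

/-- A path-continuous centered Gaussian process that is null at `0` and has the covariance function
that belongs to `v`. -/
structure IsCenteredGaussian {Ω : Type*} [MeasurableSpace Ω] (v : ℝ → ℝ) (X : ℝ → Ω → ℝ)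
    (P : Measure Ω) : Prop where
  measurable : ∀ t, Measurable (X t)
  gaussian : IsGaussianProcess X P
  centered : ∀ t, ∫ ω, X t ω ∂P = 0
  zero : ∀ ω, X 0 ω = 0
  continuous_paths : ∀ ω, Continuous fun t ↦ X t ω
  cov_eq : ∀ s t, cov[X s, X t; P] = covariance v s t

section Gaussian

set_option linter.unusedSectionVars false

variable {Ω : Type*} [MeasurableSpace Ω] {P : Measure Ω} [IsProbabilityMeasure P] {v : ℝ → ℝ}

theorem IsGaussianSource.isCenteredGaussian {X : ℝ → Ω → ℝ} (hX : IsGaussianSource v X P) :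
    IsCenteredGaussian v X P :=
  ⟨hX.measurable, hX.gaussian, hX.centered, hX.zero, hX.continuous_paths, hX.cov_eq⟩

namespace IsCenteredGaussian

variable {X : ℝ → Ω → ℝ}

theorem memLp (hX : IsCenteredGaussian v X P) (t : ℝ) : MemLp (X t) 2 P :=
  (hX.gaussian.hasGaussianLaw_eval t).memLp_two

theorem shift (hX : IsCenteredGaussian v X P) (hv0 : v 0 = 0) (θ : ℝ) :
    IsCenteredGaussian v (fun t ω ↦ X (θ + t) ω - X θ ω) P where
  measurable t := (hX.measurable _).sub (hX.measurable _)
  gaussian := hX.gaussian.shift θ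
  centered t := by
    rw [integral_sub ((hX.memLp _).integrable one_le_two) ((hX.memLp _).integrable one_le_two),
      hX.centered, hX.centered, sub_zero]
  zero ω := by simp
  continuous_paths ω :=
    ((hX.continuous_paths ω).comp (continuous_const.add continuous_id)).sub continuous_const
  cov_eq s t := by
    rw [covariance_fun_sub_fun_sub (hX.memLp _) (hX.memLp _) (hX.memLp _) (hX.memLp _)]
    simp only [hX.cov_eq, covariance, add_sub_add_left_eq_sub, add_sub_cancel_left, sub_self,
      abs_zero, hv0, sub_add_cancel_left, abs_neg]
    ring

/-- A linear combination of values of the process. -/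
theorem hasGaussianLaw_sum (hX : IsCenteredGaussian v X P) (I : Finset ℝ) (a : ℝ → ℝ) :
    HasGaussianLaw (fun ω ↦ ∑ i ∈ I, a i * X i ω) P := by
  simpa using (hX.gaussian.smul a).hasGaussianLaw_fun_sum (I := I)

theorem integral_sum (hX : IsCenteredGaussian v X P) (I : Finset ℝ) (a : ℝ → ℝ) :
    ∫ ω, ∑ i ∈ I, a i * X i ω ∂P = 0 := by
  rw [integral_finsetSum _ fun i _ ↦ ((hX.memLp i).integrable one_le_two).const_mul _]
  simp [integral_const_mul, hX.centered]

theorem variance_sum (hX : IsCenteredGaussian v X P) (I : Finset ℝ) (a : ℝ → ℝ) :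
    Var[fun ω ↦ ∑ i ∈ I, a i * X i ω; P] = ∑ i ∈ I, ∑ j ∈ I, a i * a j * covariance v i j := by
  rw [variance_fun_sum' fun i _ ↦ (hX.memLp i).const_mul (a i)]
  simp only [covariance_const_mul_left, covariance_const_mul_right, hX.cov_eq]
  exact Finset.sum_congr rfl fun i _ ↦ Finset.sum_congr rfl fun j _ ↦ by ring

theorem map_sum (hX : IsCenteredGaussian v X P) (I : Finset ℝ) (a : ℝ → ℝ) :
    P.map (fun ω ↦ ∑ i ∈ I, a i * X i ω) =
      gaussianReal 0 (∑ i ∈ I, ∑ j ∈ I, a i * a j * covariance v i j).toNNReal := by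
  rw [(hX.hasGaussianLaw_sum I a).map_eq_gaussianReal, hX.integral_sum, hX.variance_sum]

theorem map_eval (hX : IsCenteredGaussian v X P) (hv0 : v 0 = 0) (t : ℝ) :
    P.map (X t) = gaussianReal 0 (v |t|).toNNReal := by
  rw [(hX.gaussian.hasGaussianLaw_eval t).map_eq_gaussianReal, hX.centered,
    ← covariance_self (hX.measurable t).aemeasurable, hX.cov_eq]
  simp [covariance, hv0]

/-- The finite-dimensional laws are determined by `v`. -/
theorem map_restrict_eq {Y : ℝ → Ω → ℝ} (hX : IsCenteredGaussian v X P)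
    (hY : IsCenteredGaussian v Y P) (I : Finset ℝ) :
    P.map (fun ω ↦ I.restrict (X · ω)) = P.map (fun ω ↦ I.restrict (Y · ω)) := by
  classical
  have key {Z : ℝ → Ω → ℝ} (hZ : IsCenteredGaussian v Z P) (L : StrongDual ℝ (I → ℝ)) :
      charFunDual (P.map (fun ω ↦ I.restrict (Z · ω))) L = Complex.exp (-(∑ i ∈ I, ∑ j ∈ I,
        (if h : i ∈ I then L (Pi.single ⟨i, h⟩ 1) else 0) *
        (if h : j ∈ I then L (Pi.single ⟨j, h⟩ 1) else 0) * covariance v i j : ℝ) / 2) := by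
    have hL : (fun ω ↦ L (I.restrict (Z · ω))) = fun ω ↦ ∑ i ∈ I,
        (if h : i ∈ I then L (Pi.single ⟨i, h⟩ 1) else 0) * Z i ω := by
      funext ω
      rw [← Finset.sum_coe_sort I]
      conv_lhs => rw [← Finset.univ_sum_single (I.restrict (Z · ω))]
      rw [_root_.map_sum]
      refine Finset.sum_congr rfl fun i _ ↦ ?_
      have e : (Pi.single i (I.restrict (Z · ω) i) : I → ℝ) = Z i ω • Pi.single i 1 := by
        ext j
        simp [Pi.single_apply]
      rw [dif_pos i.2, e, map_smul, smul_eq_mul, mul_comm]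
    rw [(hZ.gaussian.hasGaussianLaw I).charFunDual_map_eq_fun, hL, hZ.integral_sum,
      hZ.variance_sum]
    congr 1
    simp [neg_div]
  have := (hX.gaussian.hasGaussianLaw I).isGaussian_map
  have := (hY.gaussian.hasGaussianLaw I).isGaussian_map
  refine Measure.ext_of_charFunDual ?_
  ext L
  rw [key hX, key hY]

/-- Carries the quantile `a` found for one process over to all processes with the same `v`, in
particular to the normalised sums for all `n` at once. -/
theorem measure_forall_le_eq {Y : ℝ → Ω → ℝ} (hX : IsCenteredGaussian v X P)
    (hY : IsCenteredGaussian v Y P) (I : Finset ℝ) (a : ℝ) :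
    P {ω | ∀ i ∈ I, |X i ω| ≤ a} = P {ω | ∀ i ∈ I, |Y i ω| ≤ a} := by
  have key {Z : ℝ → Ω → ℝ} (hZ : IsCenteredGaussian v Z P) : P {ω | ∀ i ∈ I, |Z i ω| ≤ a} =
      P.map (fun ω ↦ I.restrict (Z · ω)) {x | ∀ i, |x i| ≤ a} := by
    have hm : Measurable fun ω ↦ I.restrict (Z · ω) := measurable_pi_iff.2 fun i ↦ hZ.measurable i
    rw [Measure.map_apply hm]
    · simp [Set.preimage]
    · rw [Set.ofPred_forall]
      exact MeasurableSet.iInter fun i ↦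
        measurableSet_le (measurable_pi_apply i).abs measurable_const
  rw [key hX, key hY, hX.map_restrict_eq hY]

/-- The (universal) constant in Fernique's inequality. -/
noncomputable def ferniqueConst : ENNReal :=
  ENNReal.ofReal (Real.exp (Fernique.logRatio (3 / 4))) + ∑' n : ℕ, ENNReal.ofReal (Real.exp
    (-2⁻¹ * Real.log ((3 / 4 : ENNReal) / (1 - 3 / 4)).toReal * 2 ^ n))

theorem inv_two_lt_three_quarters : (2⁻¹ : ENNReal) < 3 / 4 := by
  rw [ENNReal.lt_div_iff_mul_lt (by simp) (by simp)]
  have : (4 : ENNReal) = 2 * 2 := by norm_num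
  rw [this, ← mul_assoc, ENNReal.inv_mul_cancel (by simp) (by simp), one_mul]
  norm_num

theorem three_quarters_lt_one : (3 / 4 : ENNReal) < 1 := by
  rw [ENNReal.div_lt_iff (by simp) (by simp)]
  norm_num

theorem one_sub_three_quarters : (1 - 3 / 4 : ENNReal) = 1 / 4 := by
  refine ENNReal.sub_eq_of_eq_add (by finiteness) ?_
  rw [← ENNReal.add_div]
  norm_num [ENNReal.div_self]

theorem ferniqueConst_ne_top : ferniqueConst ≠ ⊤ := by
  refine ENNReal.add_ne_top.2 ⟨ENNReal.ofReal_ne_top, ?_⟩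
  refine (Summable.tsum_ofReal_lt_top <|
    Real.summable_exp_nat_mul_of_ge ?_ (fun i ↦ mod_cast (Nat.lt_pow_self (by simp)).le)).ne
  refine mul_neg_of_neg_of_pos (by simp) (Real.log_pos ?_)
  rw [one_sub_three_quarters]
  simp

/-- A centered Gaussian vector is invariant under rotation of two independent copies, so Fernique's
theorem turns a `3 / 4`-quantile of the sup norm into a square-exponential moment; Markov's
inequality finishes. The constant does not depend on the size of `I`. -/
theorem measure_exists_finset_le (hX : IsCenteredGaussian v X P) (I : Finset ℝ) {a y : ℝ}
    (ha0 : 0 ≤ a) (hy : 0 ≤ y) (ha : (3 / 4 : ENNReal) ≤ P {ω | ∀ i ∈ I, |X i ω| ≤ a}) :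
    P {ω | ∃ i ∈ I, y < |X i ω|} ≤
      ferniqueConst * ENNReal.ofReal (Real.exp (-(Fernique.logRatio (3 / 4) * (y / a) ^ 2))) := by
  have hG := (hX.gaussian.hasGaussianLaw I).isGaussian_map
  have hm : Measurable fun ω ↦ I.restrict (X · ω) := measurable_pi_iff.2 fun i ↦ hX.measurable i
  set μ := P.map fun ω ↦ I.restrict (X · ω) with hμ
  have h0 : ∫ x, id x ∂μ = 0 := by
    have hi : Integrable id μ := IsGaussian.integrable_id
    ext i
    rw [eval_integral fun i ↦ hi.eval i, hμ, integral_map hm.aemeasurable]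
    · exact hX.centered i
    · exact (measurable_pi_apply i).aestronglyMeasurable
  have h1 : (3 / 4 : ENNReal) ≤ μ {x | ‖x‖ ≤ a} := by
    rw [hμ, Measure.map_apply hm (measurableSet_le measurable_norm measurable_const)]
    refine ha.trans (measure_mono fun ω hω ↦ ?_)
    exact (pi_norm_le_iff_of_nonneg ha0).2 fun i ↦ hω i i.2
  have h2 := lintegral_exp_mul_sq_norm_le_of_map_rotation_eq_self
    (IsGaussian.map_rotation_eq_self h0 _) h1 inv_two_lt_three_quarters
  have hγ : 0 < Fernique.logRatio (3 / 4) :=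
    Fernique.logRatio_pos inv_two_lt_three_quarters three_quarters_lt_one
  set γ := Fernique.logRatio (3 / 4)
  change _ ≤ ferniqueConst at h2
  have h3 : P {ω | ∃ i ∈ I, y < |X i ω|} ≤
      μ {x | ENNReal.ofReal (Real.exp (γ * (y / a) ^ 2)) ≤
        ENNReal.ofReal (Real.exp (γ * a⁻¹ ^ 2 * ‖x‖ ^ 2))} := by
    rw [hμ, Measure.map_apply hm (measurableSet_le (by fun_prop) (by fun_prop))]
    refine measure_mono fun ω ⟨i, hi, hω⟩ ↦ ENNReal.ofReal_le_ofReal (Real.exp_le_exp.2 ?_)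
    have : y ≤ ‖I.restrict (X · ω)‖ := hω.le.trans (norm_le_pi_norm (I.restrict (X · ω)) ⟨i, hi⟩)
    rw [div_pow, inv_pow, mul_assoc, div_eq_inv_mul]
    gcongr
  refine h3.trans ((meas_ge_le_lintegral_div (by fun_prop) (by simp [Real.exp_pos])
    ENNReal.ofReal_ne_top).trans ?_)
  rw [ENNReal.div_eq_inv_mul, mul_comm, Real.exp_neg, ENNReal.ofReal_inv_of_pos (Real.exp_pos _)]
  gcongr

/-- Paths are continuous and the condition is open, so a countable dense set of times decides the
event. -/
theorem setOf_exists_eq (hX : IsCenteredGaussian v X P) {h : ℝ} (hh : 0 ≤ h) :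
    ∃ d : ℕ → ℝ, (∀ n, d n ∈ Icc 0 h) ∧ ∀ y,
      {ω | ∃ r ∈ Icc 0 h, y < |X r ω|} = ⋃ n, {ω | y < |X (d n) ω|} := by
  have : Nonempty (Icc 0 h) := ⟨0, le_rfl, hh⟩
  refine ⟨fun n ↦ TopologicalSpace.denseSeq (Icc 0 h) n, fun n ↦ Subtype.prop _, fun y ↦ ?_⟩
  ext ω
  simp only [mem_ofPred_eq, mem_iUnion]
  refine ⟨fun ⟨r, hr, hy⟩ ↦ ?_, fun ⟨n, hn⟩ ↦ ⟨_, Subtype.prop _, hn⟩⟩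
  have hc : Continuous fun r : Icc 0 h ↦ |X r ω| :=
    ((hX.continuous_paths ω).comp continuous_subtype_val).abs
  exact (TopologicalSpace.denseRange_denseSeq (Icc 0 h)).exists_mem_open
    (isOpen_lt continuous_const hc) ⟨⟨r, hr⟩, hy⟩

theorem measurableSet_exists (hX : IsCenteredGaussian v X P) {h : ℝ} (hh : 0 ≤ h) (y : ℝ) :
    MeasurableSet {ω | ∃ r ∈ Icc 0 h, y < |X r ω|} := by
  obtain ⟨d, -, hd⟩ := hX.setOf_exists_eq hh
  rw [hd]
  exact MeasurableSet.iUnion fun n ↦ measurableSet_lt measurable_const (hX.measurable _).abs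

theorem measure_exists_le (hX : IsCenteredGaussian v X P) {h a y : ℝ} (hh : 0 ≤ h)
    (ha0 : 0 ≤ a) (hy : 0 ≤ y)
    (ha : ∀ I : Finset ℝ, ↑I ⊆ Icc 0 h → (3 / 4 : ENNReal) ≤ P {ω | ∀ i ∈ I, |X i ω| ≤ a}) :
    P {ω | ∃ r ∈ Icc 0 h, y < |X r ω|} ≤
      ferniqueConst * ENNReal.ofReal (Real.exp (-(Fernique.logRatio (3 / 4) * (y / a) ^ 2))) := by
  classical
  obtain ⟨d, hdh, hd⟩ := hX.setOf_exists_eq hh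
  have hU : (⋃ n, {ω | y < |X (d n) ω|}) =
      ⋃ N, {ω | ∃ i ∈ (Finset.range N).image d, y < |X i ω|} := by
    ext ω
    simp only [mem_iUnion, mem_ofPred_eq, Finset.mem_image, Finset.mem_range]
    exact ⟨fun ⟨n, hn⟩ ↦ ⟨n + 1, _, ⟨n, n.lt_succ_self, rfl⟩, hn⟩,
      fun ⟨_, _, ⟨n, _, hn⟩, h⟩ ↦ ⟨n, hn ▸ h⟩⟩
  have hmono : Monotone fun N ↦ {ω | ∃ i ∈ (Finset.range N).image d, y < |X i ω|} := by
    intro N M hNM ω ⟨i, hi, hω⟩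
    exact ⟨i, Finset.image_subset_image (Finset.range_mono hNM) hi, hω⟩
  rw [hd, hU, hmono.measure_iUnion]
  refine iSup_le fun N ↦ hX.measure_exists_finset_le _ ha0 hy (ha _ ?_)
  simp only [Finset.coe_image, Finset.coe_range, image_subset_iff]
  exact fun n _ ↦ hdh n

/-- Continuity from above: exceedance events that decrease to the empty set eventually have
probability below `1 / 4`. It serves both for a fixed interval with growing levels and for a fixed
level with shrinking intervals. -/
theorem three_quarters_le_of_tendsto (hX : IsCenteredGaussian v X P) {h a : ℕ → ℝ}
    (hh : Antitone h) (h0 : ∀ n, 0 ≤ h n) (ha : Monotone a)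
    (hlim : ∀ ω, ∃ n, ∀ r ∈ Icc 0 (h n), |X r ω| ≤ a n) :
    ∃ n, ∀ I : Finset ℝ, ↑I ⊆ Icc 0 (h n) → (3 / 4 : ENNReal) ≤ P {ω | ∀ i ∈ I, |X i ω| ≤ a n} := by
  have ht := tendsto_measure_iInter_atTop (μ := P)
    (s := fun n ↦ {ω | ∃ r ∈ Icc 0 (h n), a n < |X r ω|})
    (fun n ↦ (hX.measurableSet_exists (h0 n) _).nullMeasurableSet)
    (fun n m hnm ω ⟨r, hr, hω⟩ ↦ ⟨r, ⟨hr.1, hr.2.trans (hh hnm)⟩, (ha hnm).trans_lt hω⟩)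
    ⟨0, measure_ne_top _ _⟩
  have he : (⋂ n, {ω | ∃ r ∈ Icc 0 (h n), a n < |X r ω|}) = ∅ := by
    refine eq_empty_of_forall_notMem fun ω hω ↦ ?_
    obtain ⟨n, hn⟩ := hlim ω
    obtain ⟨r, hr, hlt⟩ := mem_iInter.1 hω n
    exact (hn r hr).not_gt hlt
  rw [he, measure_empty] at ht
  obtain ⟨n, hn⟩ := (ht.eventually_lt_const (show (0 : ENNReal) < 1 / 4 by simp)).exists
  refine ⟨n, fun I hI ↦ ?_⟩
  calc (3 / 4 : ENNReal) = 1 - (1 - 3 / 4) :=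
        (ENNReal.sub_sub_cancel (by simp) three_quarters_lt_one.le).symm
    _ = 1 - 1 / 4 := by rw [one_sub_three_quarters]
    _ ≤ 1 - P {ω | ∃ r ∈ Icc 0 (h n), a n < |X r ω|} := by gcongr; exact hn.le
    _ = P {ω | ∃ r ∈ Icc 0 (h n), a n < |X r ω|}ᶜ :=
        (prob_compl_eq_one_sub (hX.measurableSet_exists (h0 n) _)).symm
    _ ≤ _ := measure_mono fun ω hω i hi ↦ not_lt.1 fun hlt ↦ hω ⟨i, hI hi, hlt⟩

/-- The maximum over a compact interval has a Gaussian tail, with constants that only depend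
on `v`. -/
theorem exists_measure_exists_le (hX : IsCenteredGaussian v X P) {h : ℝ} (hh : 0 ≤ h) :
    ∃ κ > 0, ∀ {Y : ℝ → Ω → ℝ}, IsCenteredGaussian v Y P → ∀ y ≥ 0,
      P {ω | ∃ r ∈ Icc 0 h, y < |Y r ω|} ≤
        ferniqueConst * ENNReal.ofReal (Real.exp (-(κ * y ^ 2))) := by
  obtain ⟨n, hn⟩ := hX.three_quarters_le_of_tendsto (h := fun _ ↦ h) (a := fun n ↦ (n : ℝ) + 1)
    antitone_const (fun _ ↦ hh) (fun n m hnm ↦ by simpa using hnm) fun ω ↦ by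
      obtain ⟨C, hC⟩ := (isCompact_Icc (a := 0) (b := h)).exists_bound_of_continuousOn
        (hX.continuous_paths ω).continuousOn
      obtain ⟨n, hn⟩ := exists_nat_ge C
      exact ⟨n, fun r hr ↦ (hC r hr).trans (by linarith)⟩
  have hγ : 0 < Fernique.logRatio (3 / 4) :=
    Fernique.logRatio_pos inv_two_lt_three_quarters three_quarters_lt_one
  refine ⟨Fernique.logRatio (3 / 4) / ((n : ℝ) + 1) ^ 2, by positivity, fun hY y hy ↦ ?_⟩
  have := hY.measure_exists_le hh (a := (n : ℝ) + 1) (by positivity) hy fun I hI ↦ by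
    rw [hY.measure_forall_le_eq hX]
    exact hn I hI
  rwa [div_pow, mul_div_assoc', mul_div_right_comm] at this

/-- The Gaussian tail of the maximum over `[0, h]` becomes arbitrarily light as `h → 0`. -/
theorem exists_measure_exists_le_of_small (hX : IsCenteredGaussian v X P) {ε : ℝ} (hε : 0 < ε)
    (K : ℝ) : ∃ h₀ > 0, ∀ {Y : ℝ → Ω → ℝ}, IsCenteredGaussian v Y P → ∀ h ∈ Icc 0 h₀, ∀ y ≥ 0,
      P {ω | ∃ r ∈ Icc 0 h, ε * y < |Y r ω|} ≤
        ferniqueConst * ENNReal.ofReal (Real.exp (-(K * y ^ 2))) := by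
  have hγ : 0 < Fernique.logRatio (3 / 4) :=
    Fernique.logRatio_pos inv_two_lt_three_quarters three_quarters_lt_one
  set γ := Fernique.logRatio (3 / 4)
  have hlim : Tendsto (fun a : ℝ ↦ K * a ^ 2) (𝓝[>] 0) (𝓝 (K * 0 ^ 2)) :=
    (Continuous.tendsto (by fun_prop) 0).mono_left nhdsWithin_le_nhds
  -- The Fernique exponent at level `ε y` is `γ (ε y / a)²`; it dominates `K y²` once `K a² < γ ε²`.
  obtain ⟨a, haK, ha : 0 < a⟩ := ((hlim.eventually_lt_const
    (show K * 0 ^ 2 < γ * ε ^ 2 by simp only [ne_eq, OfNat.ofNat_ne_zero, not_false_eq_true, zero_pow, mul_zero]; positivity)).and self_mem_nhdsWithin).exists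
  obtain ⟨n, hn⟩ := hX.three_quarters_le_of_tendsto (h := fun n ↦ 1 / ((n : ℝ) + 1))
    (a := fun _ ↦ a) (fun n m hnm ↦ Nat.one_div_le_one_div hnm) (fun _ ↦ by positivity)
    monotone_const fun ω ↦ by
      have hc : ∀ᶠ r in 𝓝 (0 : ℝ), |X r ω| < a :=
        (hX.continuous_paths ω).abs.continuousAt.eventually_lt continuousAt_const
          (by simpa [hX.zero] using ha)
      obtain ⟨δ, hδ, hball⟩ := Metric.eventually_nhds_iff.1 hc
      obtain ⟨n, hn⟩ := exists_nat_one_div_lt hδ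
      refine ⟨n, fun r hr ↦ (hball ?_).le⟩
      rw [Real.dist_eq, sub_zero, abs_of_nonneg hr.1]
      exact hr.2.trans_lt hn
  refine ⟨1 / ((n : ℝ) + 1), by positivity, fun hY h hh y hy ↦ ?_⟩
  refine (hY.measure_exists_le hh.1 ha.le (mul_nonneg hε.le hy) fun I hI ↦ ?_).trans ?_
  · rw [hY.measure_forall_le_eq hX]
    exact hn I (hI.trans (Icc_subset_Icc_right hh.2))
  · refine mul_le_mul_right (ENNReal.ofReal_le_ofReal (Real.exp_le_exp.2 (neg_le_neg ?_))) _
    rw [div_pow, mul_div_assoc', le_div_iff₀ (by positivity)]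
    nlinarith [mul_le_mul_of_nonneg_right haK.le (sq_nonneg y)]

end IsCenteredGaussian

end Gaussian

/-! ### Regularity of the variance, normalised sums, and the far past. -/

section GaussianSums

variable {Ω : Type*} [MeasurableSpace Ω] {P : Measure Ω} [IsProbabilityMeasure P] {v : ℝ → ℝ}

/-- Path continuity and dominated convergence make `t ↦ E exp(i X t)` continuous; its modulus is
`exp(-v |t| / 2)`, so a logarithm recovers the variance. -/
theorem IsCenteredGaussian.tendsto_variance {X : ℝ → Ω → ℝ} (hX : IsCenteredGaussian v X P)
    (hv0 : v 0 = 0) : Tendsto (fun r ↦ v |r|) (𝓝 0) (𝓝 0) := by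
  have hpos (t) : 0 ≤ v |t| := by
    have h : cov[X t, X t; P] = v |t| := by rw [hX.cov_eq]; simp [covariance, hv0]
    rw [← h, covariance_self (hX.measurable t).aemeasurable]
    exact variance_nonneg _ _
  have hF : Continuous fun t ↦ ∫ ω, Complex.exp (X t ω * Complex.I) ∂P := by
    refine continuous_of_dominated (bound := fun _ ↦ 1) (fun t ↦ ?_) (fun t ↦ ?_)
      (integrable_const _) ?_
    · have := hX.measurable t
      exact Measurable.aestronglyMeasurable (by fun_prop)
    · exact Eventually.of_forall fun ω ↦ (Complex.norm_exp_ofReal_mul_I _).le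
    · refine Eventually.of_forall fun ω ↦ ?_
      have := hX.continuous_paths ω
      fun_prop
  have hFe (t) : ‖∫ ω, Complex.exp (X t ω * Complex.I) ∂P‖ = Real.exp (-(v |t| / 2)) := by
    have h1 : charFun (P.map (X t)) 1 = ∫ ω, Complex.exp (X t ω * Complex.I) ∂P := by
      rw [charFun_apply_real, integral_map (hX.measurable t).aemeasurable
        (Measurable.aestronglyMeasurable (by fun_prop))]
      simp
    rw [← h1, hX.map_eval hv0, charFun_gaussianReal, Complex.norm_exp]
    simp [hpos t]
  have h2 : Continuous fun t ↦ v |t| := by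
    have : (fun t ↦ v |t|) =
        fun t ↦ -(2 * Real.log ‖∫ ω, Complex.exp (X t ω * Complex.I) ∂P‖) := by
      funext t
      rw [hFe, Real.log_exp]
      ring
    rw [this]
    refine (continuous_const.mul (hF.norm.log fun t ↦ ?_)).neg
    rw [hFe]
    exact (Real.exp_pos _).ne'
  simpa [hv0] using h2.tendsto 0

theorem IsGaussianSource.isRegularVariance {X : ℝ → Ω → ℝ} (hX : IsGaussianSource v X P)
    (hv : ∃ α : ℝ, α < 2 ∧ Tendsto (fun t : ℝ ↦ v t / t ^ α) atTop (𝓝 0)) :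
    IsRegularVariance v := by
  have hv0 : v 0 = 0 := by
    have := hX.variance_increment 0 0 le_rfl
    rw [sub_self] at this
    rw [← this]
    simp only [sub_self]
    exact variance_zero P
  refine ⟨hv0, hX.isCenteredGaussian.tendsto_variance hv0, ?_⟩
  obtain ⟨α, hα, hlim⟩ := hv
  refine ⟨max α 0, le_max_right _ _, max_lt hα two_pos, ?_⟩
  filter_upwards [hlim.eventually_lt_const one_pos, eventually_ge_atTop 1] with t h1 ht
  rw [div_lt_one (by positivity)] at h1
  exact h1.le.trans (Real.rpow_le_rpow_of_exponent_le ht (le_max_left _ _))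

/-- Normalised sums of independent copies. -/
theorem IsCenteredGaussian.normalised_sum {A : ℕ → ℝ → Ω → ℝ}
    (hA : ∀ i, IsCenteredGaussian v (A i) P) (hindep : iIndepFun (fun i ω t ↦ A i t ω) P) {n : ℕ}
    (hn : n ≠ 0) :
    IsCenteredGaussian v (fun t ω ↦ (√n)⁻¹ * ∑ i ∈ Finset.range n, A i t ω) P where
  measurable t := (Finset.measurable_fun_sum _ fun i _ ↦ (hA i).measurable t).const_mul _
  gaussian := by
    constructor
    intro I
    have h1 : iIndepFun (fun (i : Fin n) ω ↦ I.restrict fun t ↦ A i t ω) P :=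
      (hindep.comp (fun _ f ↦ I.restrict f) fun _ ↦ Finset.measurable_restrict I).precomp
        Fin.val_injective
    have h2 := (iIndepFun.hasGaussianLaw_fun_sum
      (X := fun (i : Fin n) ω ↦ I.restrict fun t ↦ A i t ω) (fun i ↦ (hA i).gaussian.hasGaussianLaw I) h1).fun_smul ((√n)⁻¹)
    have h3 : (fun ω ↦ I.restrict fun t ↦ (√n)⁻¹ * ∑ i ∈ Finset.range n, A i t ω) =
        fun ω ↦ (√n)⁻¹ • ∑ i : Fin n, I.restrict fun t ↦ A i t ω := by
      funext ω
      ext t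
      simp [Finset.sum_range]
    rw [h3]
    exact h2
  centered t := by
    rw [integral_const_mul, integral_finsetSum _ fun i _ ↦ ((hA i).memLp t).integrable one_le_two]
    simp [(hA _).centered]
  zero ω := by simp [(hA _).zero]
  continuous_paths ω := by
    exact continuous_const.mul (continuous_finsetSum _ fun i _ ↦ (hA i).continuous_paths ω)
  cov_eq s t := by
    simp only [Finset.sum_range]
    rw [covariance_const_mul_left, covariance_const_mul_right,
      covariance_fun_sum_fun_sum (X := fun i : Fin n ↦ A i s) (Y := fun i : Fin n ↦ A i t)
        (fun i ↦ (hA i).memLp s) fun i ↦ (hA i).memLp t]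
    have h (i j : Fin n) : cov[A i s, A j t; P] = if i = j then covariance v s t else 0 := by
      split_ifs with hij
      · rw [hij, (hA j).cov_eq]
      · have h1 : IndepFun (A i s) (A j t) P :=
          (hindep.indepFun (Fin.val_injective.ne hij)).comp (measurable_pi_apply s)
            (measurable_pi_apply t)
        exact h1.covariance_eq_zero ((hA i).memLp s) ((hA j).memLp t)
    simp_rw [h]
    simp only [Finset.sum_ite_eq, Finset.mem_univ, if_true, Finset.sum_const, Finset.card_univ,
      Fintype.card_fin, nsmul_eq_mul]
    have : (√n : ℝ) * √n = n := Real.mul_self_sqrt n.cast_nonneg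
    have h0 : (√n : ℝ) ≠ 0 := by positivity
    field_simp
    rw [sq, this]

/-- Chernoff's bound with tilt `y / V`, the optimal one for variance `V`. -/
theorem measure_ge_le_of_map_eq_gaussianReal {Z : Ω → ℝ} {σ2 : NNReal} (hZ : Measurable Z)
    (h : P.map Z = gaussianReal 0 σ2) {V y : ℝ} (hV : 0 < V) (hσ : σ2 ≤ V) (hy : 0 ≤ y) :
    P {ω | y ≤ Z ω} ≤ ENNReal.ofReal (Real.exp (-(y ^ 2 / (2 * V)))) := by
  have hint : Integrable (fun ω ↦ Real.exp (y / V * Z ω)) P := by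
    have := integrable_exp_mul_gaussianReal (μ := 0) (v := σ2) (y / V)
    rw [← h, integrable_map_measure (by fun_prop) hZ.aemeasurable] at this
    exact this
  have h1 := measure_ge_le_exp_mul_mgf (μ := P) (X := Z) (t := y / V) y (by positivity) hint
  rw [mgf_gaussianReal h, ← Real.exp_add] at h1
  rw [← ENNReal.ofReal_toReal (measure_ne_top P _)]
  refine ENNReal.ofReal_le_ofReal (h1.trans (Real.exp_le_exp.2 ?_))
  have h2 : σ2 * (y / V) ^ 2 / 2 ≤ V * (y / V) ^ 2 / 2 := by gcongr
  have h3 : V * (y / V) ^ 2 / 2 = y ^ 2 / (2 * V) := by field_simp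
  have h4 : -(y / V) * y = -(2 * (y ^ 2 / (2 * V))) := by field_simp
  linarith

theorem pow_add_pow_le_add_pow (x y : ENNReal) {n : ℕ} (hn : n ≠ 0) :
    x ^ n + y ^ n ≤ (x + y) ^ n := by
  obtain ⟨m, rfl⟩ := Nat.exists_eq_succ_of_ne_zero hn
  simp only [pow_succ', Nat.succ_eq_add_one, add_mul]
  gcongr
  · exact le_self_add
  · exact le_add_self

/-- Lets a union bound over infinitely many cells, each of order `f k ^ n`, keep the exponential
form in `n` without a prefactor. -/
theorem tsum_pow_le_pow_tsum (f : ℕ → ENNReal) {n : ℕ} (hn : n ≠ 0) :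
    ∑' k, f k ^ n ≤ (∑' k, f k) ^ n := by
  obtain ⟨m, rfl⟩ := Nat.exists_eq_succ_of_ne_zero hn
  simp only [pow_succ', Nat.succ_eq_add_one, ← ENNReal.tsum_mul_right]
  refine ENNReal.tsum_le_tsum fun k ↦ ?_
  gcongr
  exact ENNReal.le_tsum k

theorem tsum_exp_neg_rpow_ne_top {q p : ℝ} (hq : 0 < q) (hp : 0 < p) :
    ∑' k : ℕ, ENNReal.ofReal (Real.exp (-(q * (k : ℝ) ^ p))) ≠ ⊤ := by
  refine Summable.tsum_ofReal_ne_top ?_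
  have h1 := ((isLittleO_exp_neg_mul_rpow_atTop hq (-2 / p)).comp_tendsto
    ((tendsto_rpow_atTop hp).comp tendsto_natCast_atTop_atTop)).isBigO
  refine summable_of_isBigO_nat (Real.summable_nat_rpow.2 (show (-2 : ℝ) < -1 by norm_num)) ?_
  refine h1.congr (fun k ↦ by simp) fun k ↦ ?_
  simp only [Function.comp_apply]
  rw [← Real.rpow_mul k.cast_nonneg, mul_div_cancel₀ _ hp.ne']

theorem IsCenteredGaussian.map_neg_eval {X : ℝ → Ω → ℝ} (hX : IsCenteredGaussian v X P)
    (hv0 : v 0 = 0) (t : ℝ) : P.map (fun ω ↦ -X t ω) = gaussianReal 0 (v |t|).toNNReal := by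
  have := Measure.map_map (μ := P) measurable_neg (hX.measurable t)
  rw [hX.map_eval hv0, gaussianReal_map_neg, neg_zero] at this
  exact this.symm

/-- Far away in the past the scaled process stays above any line of positive slope, up to an event
of small exponential order. -/
theorem IsCenteredGaussian.exists_tail {X : ℝ → Ω → ℝ} (hX : IsCenteredGaussian v X P)
    (hv : IsRegularVariance v) {c : ℝ} (hc : 0 < c) (K : ℝ) :
    ∃ T > 0, ∀ {Y : ℝ → Ω → ℝ}, IsCenteredGaussian v Y P → ∀ n : ℕ, n ≠ 0 →
      P {ω | ∃ u ≤ -T, Y u ω < √n * (c * u)} ≤ ENNReal.ofReal (Real.exp (-(n * K))) := by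
  obtain ⟨κ, hκ, hosc⟩ := hX.exists_measure_exists_le zero_le_one
  obtain ⟨β, hβ0, hβ, hgrow⟩ := hv.growth
  obtain ⟨t₀, ht₀⟩ := eventually_atTop.1 hgrow
  -- The base of the Gaussian tail of `-Y (-k)` at level `√n c k / 2` with variance at most `k ^ β`.
  set a : ℕ → ENNReal := fun k ↦ ENNReal.ofReal (Real.exp (-(c ^ 2 / 8 * (k : ℝ) ^ (2 - β)))) with ha
  -- The oscillation over `[-(k + 1), -k]` at level `√n c k / 4`. The `+ 1` ensures `ferniqueConst ≤
  -- (ferniqueConst + 1) ^ n`.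
  set a' : ℕ → ENNReal := fun k ↦ (ferniqueConst + 1) *
    ENNReal.ofReal (Real.exp (-(κ * (c / 4) ^ 2 * (k : ℝ) ^ (2 : ℝ)))) with ha'
  have hsum : ∑' k, (a k + a' k) ≠ ⊤ := by
    rw [ENNReal.tsum_add, ENNReal.tsum_mul_left]
    refine ENNReal.add_ne_top.2 ⟨tsum_exp_neg_rpow_ne_top (by positivity) (by linarith),
      ENNReal.mul_ne_top (ENNReal.add_ne_top.2 ⟨ferniqueConst_ne_top, ENNReal.one_ne_top⟩)
        (tsum_exp_neg_rpow_ne_top (by positivity) two_pos)⟩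
  have htail := (ENNReal.tendsto_sum_nat_add _ hsum).eventually_lt_const
    (show 0 < ENNReal.ofReal (Real.exp (-K)) by simp [Real.exp_pos])
  obtain ⟨N, hNtail, hN1, hNt⟩ := (htail.and ((eventually_ge_atTop 1).and
    (tendsto_natCast_atTop_atTop.eventually_ge_atTop t₀))).exists
  refine ⟨N, by exact_mod_cast hN1, fun {Y} hY n hn ↦ ?_⟩
  have hn0 : (0 : ℝ) < n := by positivity
  have hsq : √(n : ℝ) ^ 2 = n := Real.sq_sqrt hn0.le
  have hbound (k : ℕ) (hk : N ≤ k) :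
      P ({ω | √n * (c * k / 2) ≤ -Y (-k) ω} ∪ {ω | ∃ r ∈ Icc (0 : ℝ) 1,
        √n * (c * k / 4) < |Y (-(k + 1) + r) ω - Y (-(k + 1)) ω|}) ≤ (a k + a' k) ^ n := by
    have hk1 : (1 : ℝ) ≤ k := by exact_mod_cast hN1.trans hk
    have hk0 : (0 : ℝ) < k := by linarith
    have hvk : v k ≤ (k : ℝ) ^ β := ht₀ k (hNt.trans (by exact_mod_cast hk))
    refine (measure_union_le _ _).trans (le_trans (add_le_add ?_ ?_)
      (pow_add_pow_le_add_pow _ _ hn))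
    · have hmap := hY.map_neg_eval hv.zero (-k)
      refine (measure_ge_le_of_map_eq_gaussianReal (hY.measurable _).neg hmap
        (V := (k : ℝ) ^ β) (by positivity) ?_ (by positivity)).trans (le_of_eq ?_)
      · rw [abs_neg, abs_of_pos hk0, Real.coe_toNNReal']
        exact max_le hvk (by positivity)
      · rw [ha, ← ENNReal.ofReal_pow (Real.exp_pos _).le, ← Real.exp_nat_mul, Real.rpow_sub hk0]
        congr 2
        rw [mul_pow, hsq, Real.rpow_two]
        field_simp
        ring
    · refine (hosc (hY.shift hv.zero _) _ (by positivity)).trans ?_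
      simp only [ha']
      rw [mul_pow (ferniqueConst + 1), ← ENNReal.ofReal_pow (Real.exp_pos _).le, ← Real.exp_nat_mul]
      gcongr
      · exact le_self_add.trans (le_self_pow₀ le_add_self hn)
      · rw [mul_pow, hsq, Real.rpow_two]
        apply le_of_eq
        ring
  -- With `k = ⌊-u⌋₊`, going from `-k` to `-(k + 1)` and on to `u` uses two oscillations, and `k / 2
  -- + k / 4 + k / 4 = k ≤ -u`.
  have hsub : {ω | ∃ u ≤ -(N : ℝ), Y u ω < √n * (c * u)} ⊆ ⋃ j : ℕ,
      ({ω | √n * (c * (j + N : ℕ) / 2) ≤ -Y (-(j + N : ℕ)) ω} ∪ {ω | ∃ r ∈ Icc (0 : ℝ) 1,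
        √n * (c * (j + N : ℕ) / 4) <
          |Y (-((j + N : ℕ) + 1) + r) ω - Y (-((j + N : ℕ) + 1)) ω|}) := by
    rintro ω ⟨u, hu, hω⟩
    have hu0 : 0 ≤ -u := by linarith [N.cast_nonneg (α := ℝ)]
    have hNk : N ≤ ⌊-u⌋₊ := Nat.le_floor (by linarith)
    obtain ⟨j, hj⟩ := Nat.exists_eq_add_of_le' hNk
    refine mem_iUnion.2 ⟨j, ?_⟩
    rw [← hj]
    set k := ⌊-u⌋₊
    have h1 : (k : ℝ) ≤ -u := Nat.floor_le hu0
    have h2 : -u < k + 1 := Nat.lt_floor_add_one _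
    by_contra hcon
    simp only [mem_union, mem_ofPred_eq, not_or, not_le, not_exists, not_and, not_lt] at hcon
    obtain ⟨h3, h4⟩ := hcon
    have h5 := abs_le.1 (h4 (u + (k + 1)) ⟨by linarith, by linarith⟩)
    have h6 := abs_le.1 (h4 1 ⟨zero_le_one, le_rfl⟩)
    have e1 : -((k : ℝ) + 1) + (u + (k + 1)) = u := by ring
    have e2 : -((k : ℝ) + 1) + 1 = -k := by ring
    rw [e1] at h5
    rw [e2] at h6
    have h7 : √n * (c * u) ≤ √n * (c * (-k)) := by gcongr; linarith
    have h8 : √(n : ℝ) * (c * (-k)) =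
      -(√n * (c * k / 2)) - √n * (c * k / 4) - √n * (c * k / 4) := by ring
    linarith [h5.1, h6.2]
  calc P {ω | ∃ u ≤ -(N : ℝ), Y u ω < √n * (c * u)}
      ≤ ∑' j, (a (j + N) + a' (j + N)) ^ n :=
        (measure_mono hsub).trans ((measure_iUnion_le _).trans
          (ENNReal.tsum_le_tsum fun j ↦ hbound (j + N) (Nat.le_add_left _ _)))
    _ ≤ (∑' j, (a (j + N) + a' (j + N))) ^ n := tsum_pow_le_pow_tsum _ hn
    _ ≤ (ENNReal.ofReal (Real.exp (-K))) ^ n := by gcongr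
    _ = ENNReal.ofReal (Real.exp (-(n * K))) := by
        rw [← ENNReal.ofReal_pow (Real.exp_pos _).le, ← Real.exp_nat_mul, mul_neg]

end GaussianSums

/-! ### Finite-dimensional large deviation upper bound for convex sets. -/

section Chernoff

variable {Ω : Type*} [MeasurableSpace Ω] {P : Measure Ω} [IsProbabilityMeasure P] {v : ℝ → ℝ}
  {H : Type*} [NormedAddCommGroup H] [InnerProductSpace ℝ H] {k : ℝ → H} {X : ℝ → Ω → ℝ}

theorem IsFeatureMap.norm_sum_sq (hk : IsFeatureMap v k) (I : Finset ℝ) (a : ℝ → ℝ) :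
    ‖∑ i ∈ I, a i • k i‖ ^ 2 = ∑ i ∈ I, ∑ j ∈ I, a i * a j * covariance v i j := by
  rw [← real_inner_self_eq_norm_sq, sum_inner]
  refine Finset.sum_congr rfl fun i _ ↦ ?_
  rw [inner_sum]
  refine Finset.sum_congr rfl fun j _ ↦ ?_
  rw [inner_smul_left, inner_smul_right, hk.inner_eq, conj_trivial]
  ring

theorem IsCenteredGaussian.map_sum_eq (hX : IsCenteredGaussian v X P) (hk : IsFeatureMap v k)
    (I : Finset ℝ) (a : ℝ → ℝ) : P.map (fun ω ↦ ∑ i ∈ I, a i * X i ω) =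
      gaussianReal 0 (‖∑ i ∈ I, a i • k i‖ ^ 2).toNNReal := by
  rw [hX.map_sum, hk.norm_sum_sq]

theorem IsCenteredGaussian.ae_sum_eq_zero (hX : IsCenteredGaussian v X P) (hk : IsFeatureMap v k)
    (I : Finset ℝ) (a : ℝ → ℝ) (ha : ∑ i ∈ I, a i • k i = 0) :
    ∀ᵐ ω ∂P, ∑ i ∈ I, a i * X i ω = 0 := by
  have h := hX.map_sum_eq hk I a
  rw [ha] at h
  simp only [norm_zero, ne_eq, OfNat.ofNat_ne_zero, not_false_eq_true, zero_pow, Real.toNNReal_zero,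
    gaussianReal_zero_var] at h
  have hm : AEMeasurable (fun ω ↦ ∑ i ∈ I, a i * X i ω) P :=
    (Finset.measurable_fun_sum _ fun i _ ↦ (hX.measurable i).const_mul _).aemeasurable
  refine ae_of_ae_map (p := fun x ↦ x = 0) hm ?_
  rw [h, ae_dirac_eq]
  exact rfl

/-- Almost surely the vector `(X t)` satisfies every linear relation among the `k t`, because such a
combination has variance 0. It therefore defines a functional on their span, which Riesz represents
there. A basis of the relations keeps the number of null sets finite. -/
theorem IsCenteredGaussian.ae_exists_eq (hX : IsCenteredGaussian v X P) (hk : IsFeatureMap v k)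
    (I : Finset ℝ) :
    ∀ᵐ ω ∂P, ∃ a : ℝ → ℝ, ∀ t ∈ I, inner ℝ (k t) (∑ i ∈ I, a i • k i) = X t ω := by
  classical
  let T : (I → ℝ) →ₗ[ℝ] H := Fintype.linearCombination ℝ (fun i : I ↦ k i)
  have hT (a : I → ℝ) : T a = ∑ i : I, a i • k i := Fintype.linearCombination_apply _ _ _
  have hext (a : I → ℝ) : ∃ a' : ℝ → ℝ, ∀ i : I, a' i = a i :=
    ⟨fun t ↦ if h : t ∈ I then a ⟨t, h⟩ else 0, fun i ↦ by simp⟩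
  let bs := Module.finBasis ℝ (LinearMap.ker T)
  have hae : ∀ᵐ ω ∂P, ∀ j, ∑ i : I, (bs j : I → ℝ) i * X i ω = 0 := by
    refine ae_all_iff.2 fun j ↦ ?_
    obtain ⟨a', ha'⟩ := hext (bs j : I → ℝ)
    have h0 : ∑ i ∈ I, a' i • k i = 0 := by
      rw [← Finset.sum_coe_sort I, ← (bs j).2, hT]
      simp only [ha']
    filter_upwards [hX.ae_sum_eq_zero hk I a' h0] with ω hω
    rw [← Finset.sum_coe_sort I] at hω
    simpa only [ha'] using hω
  filter_upwards [hae] with ω hω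
  let ℓ : Module.Dual ℝ (I → ℝ) := Fintype.linearCombination ℝ (fun i : I ↦ X i ω)
  have hℓ (a : I → ℝ) : ℓ a = ∑ i : I, a i * X i ω := by
    simp [ℓ, Fintype.linearCombination_apply]
  have hker : ℓ ∈ (LinearMap.ker T).dualAnnihilator := by
    rw [Submodule.mem_dualAnnihilator]
    intro a ha
    have h1 : ℓ.comp (LinearMap.ker T).subtype = 0 := by
      refine bs.ext fun j ↦ ?_
      simpa [hℓ] using hω j
    exact LinearMap.congr_fun h1 ⟨a, ha⟩
  rw [← LinearMap.range_dualMap_eq_dualAnnihilator_ker] at hker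
  obtain ⟨φ, hφ⟩ := hker
  let V := LinearMap.range T
  let ψ : V →L[ℝ] ℝ := LinearMap.toContinuousLinearMap (φ.comp V.subtype)
  let g : V := (InnerProductSpace.toDual ℝ V).symm ψ
  obtain ⟨a, ha⟩ := g.2
  obtain ⟨a', ha'⟩ := hext a
  refine ⟨a', fun t ht ↦ ?_⟩
  have h1 : ∑ i ∈ I, a' i • k i = g := by
    rw [← ha, hT, ← Finset.sum_coe_sort I]
    simp only [ha']
  have h2 : T (Pi.single ⟨t, ht⟩ 1) = k t := by
    rw [hT, Finset.sum_eq_single ⟨t, ht⟩]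
    · simp
    · intro j _ hj
      simp [hj]
    · simp
  have h3 : inner ℝ g (⟨T (Pi.single ⟨t, ht⟩ 1), LinearMap.mem_range_self _ _⟩ : V) =
      ψ ⟨T (Pi.single ⟨t, ht⟩ 1), LinearMap.mem_range_self _ _⟩ :=
    InnerProductSpace.toDual_symm_apply
  rw [h1, real_inner_comm]
  change inner ℝ (g : H) (T (Pi.single ⟨t, ht⟩ 1)) = φ (T (Pi.single ⟨t, ht⟩ 1)) at h3
  rw [← h2, h3]
  have h4 := LinearMap.congr_fun hφ (Pi.single ⟨t, ht⟩ 1)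
  rw [LinearMap.dualMap_apply] at h4
  rw [h4, hℓ, Finset.sum_eq_single ⟨t, ht⟩]
  · simp
  · intro j _ hj
    simp [hj]
  · simp

/-- Non-asymptotic large deviation upper bound for finitely many values of a Gaussian process and
closed convex sets. -/
theorem IsCenteredGaussian.measure_mem_convex_le (hX : IsCenteredGaussian v X P)
    (hk : IsFeatureMap v k) (I : Finset ℝ) {C : Set (I → ℝ)} (hC : IsClosed C)
    (hconv : Convex ℝ C) {L : ℝ}
    (hL : ∀ f : H, I.restrict (fun t ↦ inner ℝ (k t) f) ∈ C → 2 * L ≤ ‖f‖ ^ 2) {x : ℝ}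
    (hx : 0 < x) :
    P {ω | I.restrict (fun t ↦ x⁻¹ * X t ω) ∈ C} ≤ ENNReal.ofReal (Real.exp (-(x ^ 2 * L))) := by
  classical
  let V : Submodule ℝ H := Submodule.span ℝ (k '' I)
  have : FiniteDimensional ℝ V := FiniteDimensional.span_of_finite ℝ (I.finite_toSet.image k)
  have hsum (a : ℝ → ℝ) : ∑ i ∈ I, a i • k i ∈ V :=
    V.sum_mem fun i hi ↦ V.smul_mem _ (Submodule.subset_span ⟨i, hi, rfl⟩)
  let E : H →ₗ[ℝ] (I → ℝ) :=
    { toFun f := I.restrict fun t ↦ inner ℝ (k t) f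
      map_add' f g := by ext; simp [inner_add_right]
      map_smul' c f := by ext; simp [inner_smul_right] }
  have hE : Continuous E := continuous_pi fun i ↦ continuous_const.inner continuous_id
  -- The elements of the span that represent points of `C`; almost surely the event forces the
  -- rescaled sample into `D`.
  let D : Set H := (V : Set H) ∩ E ⁻¹' C
  have hDconv : Convex ℝ D := V.convex.inter (hconv.linear_preimage E)
  have hDc : IsComplete D := by
    have h1 : IsComplete (V : Set H) := V.complete_of_finiteDimensional
    intro F hF hFD
    obtain ⟨f, hfV, hf⟩ := h1 F hF (hFD.trans (principal_mono.2 inter_subset_left))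
    refine ⟨f, ⟨hfV, (hC.preimage hE).closure_subset (mem_closure_iff_clusterPt.2 ?_)⟩, hf⟩
    exact hF.1.mono (le_inf hf (hFD.trans (principal_mono.2 inter_subset_right)))
  have hmem (c : ℝ → ℝ) (ω : Ω) (hc : ∀ t ∈ I, inner ℝ (k t) (∑ i ∈ I, c i • k i) = X t ω)
      (hω : I.restrict (fun t ↦ x⁻¹ * X t ω) ∈ C) : x⁻¹ • ∑ i ∈ I, c i • k i ∈ D := by
    refine ⟨V.smul_mem x⁻¹ (hsum c), ?_⟩
    have : E (x⁻¹ • ∑ i ∈ I, c i • k i) = I.restrict (fun t ↦ x⁻¹ * X t ω) := by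
      ext t
      simp only [E, LinearMap.coe_mk, AddHom.coe_mk, Finset.restrict, inner_smul_right, hc t t.2]
    rw [mem_preimage, this]
    exact hω
  rcases D.eq_empty_or_nonempty with hD | hD
  · have h0 : P {ω | I.restrict (fun t ↦ x⁻¹ * X t ω) ∈ C} = 0 := by
      refine measure_mono_null (fun ω hω ↦ ?_) (hX.ae_exists_eq hk I)
      rintro ⟨a, ha⟩
      exact (hD ▸ hmem a ω ha hω : _ ∈ (∅ : Set H))
    rw [h0]
    exact zero_le
  -- The point `f` of `D` nearest to 0 gives `⟨f, d⟩ ≥ ‖f‖²` on all of `D`, so the event lies in a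
  -- half-space and a one-dimensional tail bound suffices.
  obtain ⟨f, hfD, hf⟩ := exists_norm_eq_iInf_of_complete_convex hD hDc hDconv 0
  rw [norm_eq_iInf_iff_real_inner_le_zero hDconv hfD] at hf
  have hfL := hL f hfD.2
  obtain ⟨a, ha⟩ : ∃ a : ℝ → ℝ, ∑ i ∈ I, a i • k i = f := by
    have := hfD.1
    rw [SetLike.mem_coe, Submodule.mem_span_image_finset_iff_exists_fun] at this
    obtain ⟨c, hc⟩ := this
    refine ⟨fun t ↦ if h : t ∈ I then c ⟨t, h⟩ else 0, ?_⟩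
    rw [← hc, ← Finset.sum_coe_sort I]
    simp
  rcases eq_or_ne f 0 with rfl | hf0
  · refine prob_le_one.trans ?_
    rw [ENNReal.one_le_ofReal, Real.one_le_exp_iff]
    simp only [norm_zero, ne_eq, OfNat.ofNat_ne_zero, not_false_eq_true, zero_pow] at hfL
    nlinarith [sq_nonneg x]
  have hfpos : 0 < ‖f‖ ^ 2 := by positivity
  have hm : Measurable fun ω ↦ ∑ i ∈ I, a i * X i ω :=
    Finset.measurable_fun_sum _ fun i _ ↦ (hX.measurable i).const_mul _
  calc P {ω | I.restrict (fun t ↦ x⁻¹ * X t ω) ∈ C}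
      ≤ P {ω | x * ‖f‖ ^ 2 ≤ ∑ i ∈ I, a i * X i ω} := by
        refine measure_mono_ae ?_
        filter_upwards [hX.ae_exists_eq hk I] with ω ⟨c, hc⟩ hω
        have h1 := hf _ (hmem c ω hc hω)
        rw [zero_sub, inner_neg_left, inner_sub_right, real_inner_self_eq_norm_sq,
          inner_smul_right] at h1
        have h2 : inner ℝ f (∑ i ∈ I, c i • k i) = ∑ i ∈ I, a i * X i ω := by
          conv_lhs => rw [← ha, sum_inner]
          refine Finset.sum_congr rfl fun t ht ↦ ?_
          rw [inner_smul_left, hc t ht, conj_trivial]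
        rw [h2] at h1
        have h3 : ‖f‖ ^ 2 ≤ x⁻¹ * ∑ i ∈ I, a i * X i ω := by linarith
        rwa [← div_eq_inv_mul, le_div_iff₀ hx, mul_comm] at h3
    _ ≤ ENNReal.ofReal (Real.exp (-((x * ‖f‖ ^ 2) ^ 2 / (2 * ‖f‖ ^ 2)))) := by
        refine measure_ge_le_of_map_eq_gaussianReal hm (hX.map_sum_eq hk I a) hfpos ?_
          (by positivity)
        rw [ha, Real.coe_toNNReal _ hfpos.le]
    _ ≤ _ := by
        refine ENNReal.ofReal_le_ofReal (Real.exp_le_exp.2 (neg_le_neg ?_))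
        have : (x * ‖f‖ ^ 2) ^ 2 / (2 * ‖f‖ ^ 2) = x ^ 2 * (‖f‖ ^ 2 / 2) := by field_simp
        rw [this]
        gcongr
        linarith

end Chernoff

/-! ### Deterministic analysis of the tandem. -/

section Queue

variable {x : ℝ → ℝ} {b c₁ c₂ C : ℝ}

/-- The real supremum of an unbounded set is 0 by convention, so the content has its intended value
only under a linear lower bound on the past input. -/
theorem bufferContent_bddAbove {c τ : ℝ} (hx : ∀ u ≤ 0, c * u - C ≤ x u) (hτ : τ ≤ 0) :
    BddAbove (range fun u : Iio τ ↦ x τ - x u - c * (τ - u)) := by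
  refine ⟨x τ - c * τ + C, ?_⟩
  rintro _ ⟨⟨u, hu⟩, rfl⟩
  have := hx u (le_trans (le_of_lt hu) hτ)
  simp only
  linarith

theorem lower_bound_of_le (hc : c₂ < c₁) (hx : ∀ u ≤ 0, c₂ * u - C ≤ x u) :
    ∀ u ≤ 0, c₁ * u - C ≤ x u := fun u hu ↦ by
  have := hx u hu
  nlinarith

theorem bufferOutput_le (hxc : Continuous x) (hc : c₂ < c₁) (hx : ∀ u ≤ 0, c₂ * u - C ≤ x u)
    {τ w : ℝ} (hτ : τ ≤ 0) (hw : w ≤ τ) : bufferOutput x c₁ τ ≤ x w + c₁ * (τ - w) := by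
  have hlt (w) (hw : w < τ) : x τ - x w - c₁ * (τ - w) ≤ bufferContent x c₁ τ :=
    le_ciSup (bufferContent_bddAbove (lower_bound_of_le hc hx) hτ) (⟨w, hw⟩ : Iio τ)
  have hle : x τ - x w - c₁ * (τ - w) ≤ bufferContent x c₁ τ := by
    rcases hw.lt_or_eq with hw | rfl
    · exact hlt w hw
    -- The case `w = τ` is not in the index set of the supremum; it is reached by continuity from
    -- the left.
    · have hcont : Continuous fun u ↦ x w - x u - c₁ * (w - u) := by fun_prop
      refine le_of_tendsto ((hcont.tendsto w).mono_left (nhdsWithin_le_nhds (s := Iio w))) ?_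
      filter_upwards [self_mem_nhdsWithin] with u hu using hlt u hu
  unfold bufferOutput
  linarith

theorem le_bufferOutput {τ z : ℝ} (h : ∀ w < τ, z ≤ x w + c₁ * (τ - w)) :
    z ≤ bufferOutput x c₁ τ := by
  have : Nonempty (Iio τ) := ⟨⟨τ - 1, by simp⟩⟩
  have : bufferContent x c₁ τ ≤ x τ - z := ciSup_le fun ⟨w, hw⟩ ↦ by
    have := h w hw
    simp only
    linarith
  unfold bufferOutput
  linarith

/-- The output is the infimum over `w ≤ τ` of `x w + c₁ (τ - w)`. Take a nearly optimal `u` for the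
second queue, then a nearly optimal `u' < u` for the output at `u`; moving the start from `u` to
`u'` is harmless since `c₁ > c₂`. -/
theorem exists_overflowFrom_of_lt_secondQueue (hxc : Continuous x) (hc : c₂ < c₁)
    (hx : ∀ u ≤ 0, c₂ * u - C ≤ x u) (h : b < secondQueue x c₁ c₂ 0) :
    ∃ u < 0, OverflowFrom b c₁ c₂ u x := by
  have : Nonempty (Iio (0 : ℝ)) := ⟨⟨-1, by simp⟩⟩
  obtain ⟨⟨u, hu⟩, hlt⟩ := exists_lt_of_lt_ciSup h
  simp only [zero_sub] at hlt
  obtain ⟨u', hu', hlt'⟩ : ∃ u' < u,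
      x u' + c₁ * (u - u') < bufferOutput x c₁ 0 + c₂ * u - b := by
    by_contra! hcon
    have := le_bufferOutput hcon
    linarith
  refine ⟨u', hu'.trans hu, fun w hw ↦ ?_⟩
  have h1 := bufferOutput_le hxc hc hx le_rfl hw.2
  nlinarith

/-- The start is replaced by a near-minimiser `u'` of `x w - c₂ w` over the whole past. This handles
the times `w < u`, on which the overflow condition is silent: there `x w - c₁ w` exceeds the infimum
by at least `(c₁ - c₂)(-u) ≥ b + δ`. -/
theorem lt_secondQueue_of_overflowFrom (hxc : Continuous x) (hx0 : x 0 = 0) (hb : 0 < b)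
    (hc : c₂ < c₁) (hx : ∀ u ≤ 0, c₂ * u - C ≤ x u) {u : ℝ} (hu : u < 0)
    (h : OverflowFrom b c₁ c₂ u x) : b < secondQueue x c₁ c₂ 0 := by
  obtain ⟨w₀, hw₀, hmin⟩ := (isCompact_Icc (a := u) (b := (0 : ℝ))).exists_isMinOn
    (nonempty_Icc.2 hu.le) (f := fun w ↦ x w - x u - (b - c₂ * u + c₁ * w)) (by fun_prop)
  set δ := x w₀ - x u - (b - c₂ * u + c₁ * w₀) with hδ
  have hδ0 : 0 < δ := sub_pos.2 (h w₀ hw₀)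
  have hδle (w) (hw : w ∈ Icc u 0) : b + δ + x u - c₂ * u ≤ x w - c₁ * w := by
    have := hmin hw
    simp only [mem_ofPred_eq] at this
    linarith
  set g := ⨅ w : Iic (0 : ℝ), (x w - c₂ * w) with hg
  have hbdd : BddBelow (range fun w : Iic (0 : ℝ) ↦ x w - c₂ * w) := by
    refine ⟨-C, ?_⟩
    rintro _ ⟨⟨w, hw⟩, rfl⟩
    have := hx w hw
    simp only
    linarith
  have hgle (w) (hw : w ≤ 0) : g ≤ x w - c₂ * w := ciInf_le hbdd (⟨w, hw⟩ : Iic (0 : ℝ))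
  have : Nonempty (Iic (0 : ℝ)) := ⟨⟨0, by simp⟩⟩
  obtain ⟨⟨u', hu'⟩, hlt⟩ := exists_lt_of_ciInf_lt (show g < g + δ / 2 by linarith)
  simp only at hlt
  have hgu := hgle u hu.le
  have h0 := hδle 0 ⟨hu.le, le_rfl⟩
  have hu0 : u' < 0 := by
    rcases lt_or_eq_of_le (show u' ≤ 0 from hu') with h1 | rfl
    · exact h1
    · rw [hx0] at hlt h0
      linarith
  have hy0 : b + δ / 2 + x u' - c₂ * u' ≤ bufferOutput x c₁ 0 := by
    refine le_bufferOutput fun w hw ↦ ?_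
    rcases le_or_gt u w with huw | huw
    · have := hδle w ⟨huw, hw.le⟩
      linarith
    · have h1 := hgle w hw.le
      have h2 := hδle u ⟨le_rfl, hu.le⟩
      nlinarith
  have hyu := bufferOutput_le hxc hc hx hu0.le le_rfl
  have hbdd2 : BddAbove (range fun r : Iio (0 : ℝ) ↦
      bufferOutput x c₁ 0 - bufferOutput x c₁ r - c₂ * (0 - r)) := by
    refine bufferContent_bddAbove (C := C) (fun r hr ↦ le_bufferOutput fun w hw ↦ ?_) le_rfl
    have := hx w (hw.le.trans hr)
    nlinarith
  refine lt_of_lt_of_le ?_ (le_ciSup hbdd2 ⟨u', hu0⟩)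
  simp only
  linarith

end Queue

/-! ### Upper bound for the overflow probability. -/

section Upper

variable {Ω : Type*} [MeasurableSpace Ω] {P : Measure Ω} [IsProbabilityMeasure P] {v : ℝ → ℝ}
  {H : Type*} [NormedAddCommGroup H] [InnerProductSpace ℝ H] {k : ℝ → H} {X : ℝ → Ω → ℝ}

/-- The points of the grid `I` see a weak overflow that starts at `p`. -/
def gridOverflow (b c₁ c₂ p : ℝ) (I : Finset ℝ) : Set (I → ℝ) :=
  {y | ∀ i i' : I, (i' : ℝ) = p → p ≤ i → b - c₂ * p + c₁ * i ≤ y i - y i'}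

theorem isClosed_gridOverflow (b c₁ c₂ p : ℝ) (I : Finset ℝ) :
    IsClosed (gridOverflow b c₁ c₂ p I) := by
  simp only [gridOverflow, Set.ofPred_forall]
  refine isClosed_iInter fun i ↦ isClosed_iInter fun i' ↦ isClosed_iInter fun _ ↦
    isClosed_iInter fun _ ↦ isClosed_le continuous_const ?_
  exact (continuous_apply i).sub (continuous_apply i')

theorem convex_gridOverflow (b c₁ c₂ p : ℝ) (I : Finset ℝ) :
    Convex ℝ (gridOverflow b c₁ c₂ p I) := by
  intro y hy z hz α β hα hβ hαβ i i' h1 h2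
  have e : b - c₂ * p + c₁ * i = α * (b - c₂ * p + c₁ * i) + β * (b - c₂ * p + c₁ * i) := by
    rw [← add_mul, hαβ, one_mul]
  have h3 := mul_le_mul_of_nonneg_left (hy i i' h1 h2) hα
  have h4 := mul_le_mul_of_nonneg_left (hz i i' h1 h2) hβ
  rw [e]
  simp only [Pi.add_apply, Pi.smul_apply, smul_eq_mul]
  linarith

theorem exists_grid_point {h u : ℝ} (hh : 0 < h) (hu : u ≤ 0) :
    ∃ j : ℕ, -(j * h) ≤ u ∧ u < -(j * h) + h ∧ j = ⌈-u / h⌉₊ := by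
  refine ⟨⌈-u / h⌉₊, ?_, ?_, rfl⟩
  · have := Nat.le_ceil (-u / h)
    rw [div_le_iff₀ hh] at this
    linarith
  · have := Nat.ceil_lt_add_one (a := -u / h) (div_nonneg (by linarith) hh.le)
    rw [← sub_lt_iff_lt_add, lt_div_iff₀ hh] at this
    linarith

/-- A path that overflows and oscillates little on the cells of a grid overflows on the grid. -/
theorem grid_of_overflowFrom {b c₁ c₂ η h u : ℝ} {f : ℝ → ℝ} {m : ℕ} (hη : 0 ≤ η) (hh : 0 < h)
    (hc₂ : 0 < c₂) (hc : c₂ < c₁) (hmu : -(m * h) ≤ u)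
    (hum : u < -(m * h) + h) (hf : OverflowFrom b c₁ c₂ u f) (hu : u ≤ 0)
    (hosc : |f (-(m * h) + (u + m * h)) - f (-(m * h))| ≤ η) {j : ℕ} (hj : -(m * h) ≤ -(j * h)) :
    b - η - c₂ * h - c₂ * (-(m * h)) + c₁ * (-(j * h)) ≤ f (-(j * h)) - f (-(m * h)) := by
  have hjm : (j : ℝ) ≤ m := by
    rw [neg_le_neg_iff] at hj
    exact le_of_mul_le_mul_right hj hh
  have hu' := hf u ⟨le_rfl, hu⟩
  have hc2h : 0 < c₂ * h := mul_pos hc₂ hh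
  have e1 : -(m * h) + (u + m * h) = u := by ring
  rw [e1] at hosc
  -- For `j = m` the grid point may lie left of `u`, outside the overflow interval; there the
  -- constraint follows from `b < (c₁ - c₂)(-u)`. For `j < m` the losses are `η` from the value at
  -- `u` and `c₂ h` from moving the start.
  rcases eq_or_lt_of_le hjm with hjm | hjm
  · rw [hjm]
    nlinarith
  · have hjm' : (j : ℝ) + 1 ≤ m := by exact_mod_cast hjm
    have h1 := hf (-(j * h)) ⟨by nlinarith, by nlinarith [j.cast_nonneg (α := ℝ)]⟩
    have h2 := abs_le.1 hosc
    nlinarith [h2.1]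

/-- Overflow forces a start before `-T`, a large oscillation on a grid cell, or a weak overflow seen
on the grid. There are finitely many events of the last two kinds, so `C` is independent of `n`. -/
theorem IsCenteredGaussian.measure_overflow_le (hX : IsCenteredGaussian v X P)
    (hv : IsRegularVariance v) (hk : IsFeatureMap v k) {b c₁ c₂ L ε : ℝ} (hb : 0 < b)
    (hc₂ : 0 < c₂) (hc : c₂ < c₁) (hε : 0 < ε)
    (hgap : ∀ f : H, ∀ u ≤ 0, WeakOverflowFrom (b - ε) c₁ c₂ u (fun t ↦ inner ℝ (k t) f) →
      2 * L ≤ ‖f‖ ^ 2) :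
    ∃ C : ENNReal, C ≠ ⊤ ∧ ∀ {Y : ℝ → Ω → ℝ}, IsCenteredGaussian v Y P → ∀ n : ℕ, n ≠ 0 →
      P {ω | ∃ u < 0, OverflowFrom (√n * b) (√n * c₁) (√n * c₂) u fun t ↦ Y t ω} ≤
        C * ENNReal.ofReal (Real.exp (-(n * L))) := by
  classical
  obtain ⟨T, hT, htail⟩ := hX.exists_tail hv hc₂ L
  obtain ⟨h₀, hh₀, hosc⟩ := hX.exists_measure_exists_le_of_small (show 0 < ε / 4 by positivity) L
  set M := √(2 * L)
  have hM0 : M + 1 ≠ 0 := by positivity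
  obtain ⟨h₁, hh₁, hball⟩ := Metric.eventually_nhds_iff.1
    (hv.cont.eventually_lt_const (show 0 < (ε / (4 * (M + 1))) ^ 2 by positivity))
  -- The mesh keeps the total loss within `ε`: `ε / 4` for the random oscillation, `ε / 4` for the
  -- oscillation of a path of norm at most `M`, and `(c₁ + c₂) h ≤ ε / 2` for rounding start and
  -- time.
  set h := min h₀ (min (h₁ / 2) (ε / (2 * (c₁ + c₂)))) with hh
  have hc₁ : 0 < c₁ := hc₂.trans hc
  have hpos : 0 < h := lt_min hh₀ (lt_min (by positivity) (by positivity))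
  have hhh₀ : h ≤ h₀ := min_le_left _ _
  have hhh₁ : h < h₁ := ((min_le_right _ _).trans (min_le_left _ _)).trans_lt (by linarith)
  have hhε : (c₁ + c₂) * h ≤ ε / 2 := by
    have : h ≤ ε / (2 * (c₁ + c₂)) := (min_le_right _ _).trans (min_le_right _ _)
    rw [le_div_iff₀ (by positivity)] at this
    linarith
  set N := ⌈T / h⌉₊
  set p : ℕ → ℝ := fun j ↦ -(j * h) with hp
  set I : Finset ℝ := (Finset.range (N + 1)).image p with hI
  refine ⟨1 + ((N + 1 : ℕ) * ferniqueConst + (N + 1 : ℕ)), by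
    refine ENNReal.add_ne_top.2 ⟨ENNReal.one_ne_top, ENNReal.add_ne_top.2
      ⟨ENNReal.mul_ne_top (ENNReal.natCast_ne_top _) ferniqueConst_ne_top,
        ENNReal.natCast_ne_top _⟩⟩, fun {Y} hY n hn ↦ ?_⟩
  have hn0 : (0 : ℝ) < n := by positivity
  have hs0 : 0 < √(n : ℝ) := Real.sqrt_pos.2 hn0
  have hsq : √(n : ℝ) ^ 2 = n := Real.sq_sqrt hn0.le
  have hsub : {ω | ∃ u < 0, OverflowFrom (√n * b) (√n * c₁) (√n * c₂) u fun t ↦ Y t ω} ⊆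
      {ω | ∃ u ≤ -T, Y u ω < √n * (c₂ * u)} ∪
      ((⋃ j ∈ Finset.range (N + 1), {ω | ∃ r ∈ Icc 0 h, ε / 4 * √n < |Y (p j + r) ω - Y (p j) ω|}) ∪
      ⋃ m ∈ Finset.range (N + 1), {ω | I.restrict (fun t ↦ (√n)⁻¹ * Y t ω) ∈
        gridOverflow (b - ε / 4 - c₂ * h) c₁ c₂ (p m) I}) := by
    rintro ω ⟨u, hu, hω⟩
    rcases le_or_gt u (-T) with huT | huT
    · refine Or.inl ⟨u, huT, ?_⟩
      have := hω 0 ⟨hu.le, le_rfl⟩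
      simp only [hY.zero] at this
      have hb' : 0 < √n * b := mul_pos hs0 hb
      linarith
    refine Or.inr ?_
    obtain ⟨m, hm1, hm2, hm3⟩ := exists_grid_point hpos hu.le
    have hmN : m ∈ Finset.range (N + 1) := by
      rw [Finset.mem_range, Nat.lt_succ_iff, hm3]
      refine Nat.ceil_mono ?_
      gcongr
      linarith
    rcases lt_or_ge (ε / 4 * √n) |Y (p m + (u + m * h)) ω - Y (p m) ω| with hlt | hle
    · refine Or.inl (mem_iUnion₂.2 ⟨m, hmN, u + m * h, ⟨by linarith, by linarith⟩, hlt⟩)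
    · refine Or.inr (mem_iUnion₂.2 ⟨m, hmN, fun i i' hi' hi ↦ ?_⟩)
      obtain ⟨j, -, hj⟩ := Finset.mem_image.1 i.2
      simp only [Finset.restrict, ← mul_sub, hi']
      rw [← hj] at hi ⊢
      have := grid_of_overflowFrom (f := fun t ↦ Y t ω) (by positivity) hpos (mul_pos hs0 hc₂)
        (mul_lt_mul_of_pos_left hc hs0) hm1 hm2 hω hu.le hle hi
      rw [← div_eq_inv_mul, le_div_iff₀ hs0]
      simp only [hp]
      linarith
  -- A path of squared norm below `2 L` that overflows on the grid would, by its modulus of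
  -- continuity, overflow weakly at level `b - ε`, against the gap.
  have hconv (m : ℕ) (f : H) (hf : I.restrict (fun t ↦ inner ℝ (k t) f) ∈
      gridOverflow (b - ε / 4 - c₂ * h) c₁ c₂ (p m) I) (hm : m ∈ Finset.range (N + 1)) :
      2 * L ≤ ‖f‖ ^ 2 := by
    by_contra! hlt
    have hfM : ‖f‖ ≤ M := Real.le_sqrt_of_sq_le hlt.le
    have hpm : p m ≤ 0 := neg_nonpos.2 (by positivity)
    refine hlt.not_ge (hgap f (p m) hpm fun w hw ↦ ?_)
    obtain ⟨j, hj1, hj2, hj3⟩ := exists_grid_point hpos hw.2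
    have hjm : j ≤ m := by
      rw [hj3]
      refine Nat.ceil_le.2 ?_
      rw [div_le_iff₀ hpos]
      have := hw.1
      simp only [hp] at this
      linarith
    have hjN : j ∈ Finset.range (N + 1) := by
      rw [Finset.mem_range] at hm ⊢
      exact hjm.trans_lt hm
    have h1 := hf ⟨p j, Finset.mem_image_of_mem _ hjN⟩ ⟨p m, Finset.mem_image_of_mem _ hm⟩ rfl (by
      simp only [hp]
      gcongr)
    simp only [Finset.restrict] at h1
    have h2 : |inner ℝ (k w - k (p j)) f| ≤ ε / 4 := by
      refine (abs_real_inner_le_norm _ _).trans ?_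
      have h3 : ‖k w - k (p j)‖ ≤ ε / (4 * (M + 1)) := by
        refine abs_le_of_sq_le_sq' ?_ (by positivity) |>.2
        rw [hk.norm_sub_sq hv]
        refine (hball ?_).le
        rw [Real.dist_eq, sub_zero, abs_lt]
        constructor <;> simp only [hp] <;> linarith
      calc ‖k w - k (p j)‖ * ‖f‖ ≤ ε / (4 * (M + 1)) * M := by gcongr
        _ ≤ ε / (4 * (M + 1)) * (M + 1) := by gcongr; linarith
        _ = ε / 4 := by field_simp
    rw [inner_sub_left] at h2
    have h4 := (abs_le.1 h2).1
    have h5 : c₁ * w - c₁ * h ≤ c₁ * p j := by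
      rw [← mul_sub]
      gcongr
      simp only [hp]
      linarith
    linarith
  refine (measure_mono hsub).trans ((measure_union_le _ _).trans ?_)
  rw [add_mul, one_mul, add_mul]
  refine add_le_add (htail hY n hn) ((measure_union_le _ _).trans (add_le_add ?_ ?_))
  · refine (measure_biUnion_finset_le _ _).trans ?_
    rw [mul_assoc, ← nsmul_eq_mul]
    refine (Finset.sum_le_card_nsmul _ _ _ fun j _ ↦ ?_).trans_eq (by rw [Finset.card_range])
    refine (hosc (hY.shift hv.zero _) h ⟨hpos.le, hhh₀⟩ _ hs0.le).trans_eq ?_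
    rw [hsq, mul_comm L]
  · refine (measure_biUnion_finset_le _ _).trans ?_
    rw [← nsmul_eq_mul]
    refine (Finset.sum_le_card_nsmul _ _ _ fun m hm ↦ ?_).trans_eq (by rw [Finset.card_range])
    refine (hY.measure_mem_convex_le hk I (isClosed_gridOverflow _ _ _ _ _)
      (convex_gridOverflow _ _ _ _ _) (fun f hf ↦ hconv m f hf hm) hs0).trans_eq ?_
    rw [hsq]

end Upper

/-! ### Lower bound for the overflow probability. -/

section Lower

variable {Ω : Type*} [MeasurableSpace Ω] {P : Measure Ω} [IsProbabilityMeasure P] {v : ℝ → ℝ}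
  {H : Type*} [NormedAddCommGroup H] [InnerProductSpace ℝ H] {k : ℝ → H} {X : ℝ → Ω → ℝ}

theorem OverflowFrom.exists_slack {b c₁ c₂ u : ℝ} {f : ℝ → ℝ} (hf : Continuous f) (hu : u ≤ 0)
    (h : OverflowFrom b c₁ c₂ u f) :
    ∃ δ > 0, ∀ w ∈ Icc u 0, b - c₂ * u + c₁ * w + δ ≤ f w - f u := by
  obtain ⟨w₀, hw₀, hmin⟩ := (isCompact_Icc (a := u) (b := (0 : ℝ))).exists_isMinOn
    (nonempty_Icc.2 hu) (f := fun w ↦ f w - f u - (b - c₂ * u + c₁ * w)) (by fun_prop)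
  refine ⟨_, sub_pos.2 (h w₀ hw₀), fun w hw ↦ ?_⟩
  have := hmin hw
  simp only [mem_ofPred_eq] at this
  linarith

/-- Finite linear combinations of kernel functions are enough to approximate overflowing paths. -/
theorem IsFeatureMap.exists_sum_overflow (hk : IsFeatureMap v k) (hv : IsRegularVariance v)
    {b c₁ c₂ u L : ℝ} (hu : u ≤ 0) {f : H}
    (hf : OverflowFrom b c₁ c₂ u fun t ↦ inner ℝ (k t) f) (hL : ‖f‖ ^ 2 < 2 * L) :
    ∃ (I : Finset ℝ) (a : ℝ → ℝ), ‖∑ i ∈ I, a i • k i‖ ^ 2 < 2 * L ∧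
      OverflowFrom b c₁ c₂ u fun t ↦ inner ℝ (k t) (∑ i ∈ I, a i • k i) := by
  have hkc := hk.continuous hv
  obtain ⟨δ, hδ, hslack⟩ := hf.exists_slack (hkc.inner continuous_const) hu
  obtain ⟨B, hB⟩ := (isCompact_Icc (a := u) (b := (0 : ℝ))).exists_bound_of_continuousOn
    (f := fun w ↦ k w - k u) (by fun_prop)
  have hB0 : 0 ≤ B := (norm_nonneg _).trans (hB u ⟨le_rfl, hu⟩)
  have h1 : ∀ᶠ g in 𝓝 f, ‖g‖ ^ 2 < 2 * L ∧ B * ‖g - f‖ < δ := by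
    refine (((continuous_norm.pow 2).continuousAt (x := f)).eventually_lt continuousAt_const hL).and ?_
    have : Continuous fun g ↦ B * ‖g - f‖ := by fun_prop
    exact (this.continuousAt (x := f)).eventually_lt continuousAt_const (by simpa using hδ)
  have hcl : f ∈ closure (Submodule.span ℝ (range k) : Set H) := by
    rw [← Submodule.topologicalClosure_coe, hk.dense]
    trivial
  obtain ⟨g, ⟨hgL, hgδ⟩, hg⟩ := mem_closure_iff_nhds.1 hcl _ h1
  obtain ⟨c, hc⟩ := (Finsupp.mem_span_range_iff_exists_finsupp).1 hg
  refine ⟨c.support, c, ?_⟩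
  change ‖c.sum fun i a ↦ a • k i‖ ^ 2 < 2 * L ∧
    OverflowFrom b c₁ c₂ u fun t ↦ inner ℝ (k t) (c.sum fun i a ↦ a • k i)
  rw [hc]
  refine ⟨hgL, fun w hw ↦ ?_⟩
  have h2 := hslack w hw
  have h3 : |inner ℝ (k w - k u) (g - f)| < δ :=
    ((abs_real_inner_le_norm _ _).trans (by gcongr; exact hB w hw)).trans_lt hgδ
  have h4 := (abs_lt.1 h3).1
  simp only [inner_sub_left, inner_sub_right] at h4
  linarith

/-- Since `cov(Z, X t) = ⟨k t, g⟩` and `Var Z = ‖g‖²`, the residual is uncorrelated with `Z`, and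
joint Gaussianity turns this into independence. -/
theorem IsCenteredGaussian.indepFun_residual (hX : IsCenteredGaussian v X P)
    (hk : IsFeatureMap v k) (I : Finset ℝ) (a : ℝ → ℝ) (hne : ∑ i ∈ I, a i • k i ≠ 0) :
    IndepFun (fun ω (_ : Unit) ↦ ∑ i ∈ I, a i * X i ω)
      (fun ω t ↦ X t ω - inner ℝ (k t) (∑ i ∈ I, a i • k i) / ‖∑ i ∈ I, a i • k i‖ ^ 2 *
        ∑ i ∈ I, a i * X i ω) P := by
  classical
  set g := ∑ i ∈ I, a i • k i with hg
  have hpos : ‖g‖ ^ 2 ≠ 0 := by positivity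
  set Z : Ω → ℝ := fun ω ↦ ∑ i ∈ I, a i * X i ω with hZ
  have hZm : Measurable Z := Finset.measurable_fun_sum _ fun i _ ↦ (hX.measurable i).const_mul _
  have hZL : MemLp Z 2 P := (hX.hasGaussianLaw_sum I a).memLp_two
  refine IsGaussianProcess.indepFun_of_covariance_eq_zero (X := fun (_ : Unit) ↦ Z)
    (Y := fun t ω ↦ X t ω - inner ℝ (k t) g / ‖g‖ ^ 2 * Z ω) ?_ (fun _ ↦ hZm.aemeasurable)
    (fun t ↦ ((hX.measurable t).sub (hZm.const_mul _)).aemeasurable) fun _ t ↦ ?_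
  · refine hX.gaussian.of_isGaussianProcess fun s ↦ ?_
    rcases s with _ | t
    · refine ⟨I, ∑ i : I, a i • ContinuousLinearMap.proj i, fun ω ↦ ?_⟩
      simp only [Sum.elim_inl, hZ, _root_.sum_apply, _root_.smul_apply,
        ContinuousLinearMap.proj_apply, Finset.restrict, smul_eq_mul]
      rw [← Finset.sum_coe_sort I]
    · refine ⟨insert t I, ContinuousLinearMap.proj ⟨t, Finset.mem_insert_self _ _⟩ -
        (inner ℝ (k t) g / ‖g‖ ^ 2) • ∑ i : I, a i •
          ContinuousLinearMap.proj ⟨i, Finset.mem_insert_of_mem i.2⟩, fun ω ↦ ?_⟩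
      simp only [Sum.elim_inr, hZ, _root_.sum_apply, _root_.smul_apply,
        _root_.sub_apply, ContinuousLinearMap.proj_apply, Finset.restrict, smul_eq_mul]
      rw [← Finset.sum_coe_sort I]
  · have hZX (t : ℝ) : cov[Z, X t; P] = inner ℝ (k t) g := by
      rw [hZ, covariance_fun_sum_left' fun i _ ↦ (hX.memLp i).const_mul _, hg, inner_sum]
      · refine Finset.sum_congr rfl fun i _ ↦ ?_
        rw [covariance_const_mul_left, hX.cov_eq, inner_smul_right, real_inner_comm, hk.inner_eq]
      · exact hX.memLp t
    have hZZ : cov[Z, Z; P] = ‖g‖ ^ 2 := by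
      rw [covariance_self hZm.aemeasurable, hZ, hX.variance_sum, hg, hk.norm_sum_sq]
    rw [covariance_fun_sub_right hZL (hX.memLp t) (hZL.const_mul _), covariance_const_mul_right,
      hZX, hZZ]
    field_simp
    ring

/-- On the interval the density is at least its value at the right endpoint, and `x ≥ 1` makes the
length at least `δ s`. -/
theorem gaussianReal_Icc_ge {s δ x : ℝ} (hs : 0 < s) (hδ : 0 < δ) (hδ1 : δ ≤ 1) (hx : 1 ≤ x) :
    ENNReal.ofReal (δ * s / √(2 * Real.pi * s) * Real.exp (-(x ^ 2 * (s / 2)))) ≤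
      gaussianReal 0 s.toNNReal (Icc (x * (s * (1 - δ))) (x * s)) := by
  have hx0 : 0 < x := by linarith
  have hs' : s.toNNReal ≠ 0 := by simpa using hs
  rw [gaussianReal_apply _ hs']
  calc ENNReal.ofReal (δ * s / √(2 * Real.pi * s) * Real.exp (-(x ^ 2 * (s / 2))))
      ≤ ENNReal.ofReal ((√(2 * Real.pi * s))⁻¹ * Real.exp (-(x ^ 2 * (s / 2)))) *
          volume (Icc (x * (s * (1 - δ))) (x * s)) := by
        rw [Real.volume_Icc, ← ENNReal.ofReal_mul (by positivity)]
        refine ENNReal.ofReal_le_ofReal ?_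
        have e : x * s - x * (s * (1 - δ)) = x * (δ * s) := by ring
        rw [e, div_eq_inv_mul]
        have : δ * s ≤ x * (δ * s) := le_mul_of_one_le_left (by positivity) hx
        calc (√(2 * Real.pi * s))⁻¹ * (δ * s) * Real.exp (-(x ^ 2 * (s / 2)))
            ≤ (√(2 * Real.pi * s))⁻¹ * (x * (δ * s)) * Real.exp (-(x ^ 2 * (s / 2))) := by gcongr
          _ = _ := by ring
    _ = ∫⁻ _ in Icc (x * (s * (1 - δ))) (x * s),
          ENNReal.ofReal ((√(2 * Real.pi * s))⁻¹ * Real.exp (-(x ^ 2 * (s / 2)))) := by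
        rw [setLIntegral_const]
    _ ≤ _ := by
        refine setLIntegral_mono (measurable_gaussianPDF _ _) fun z hz ↦ ?_
        rw [gaussianPDF, gaussianPDFReal, Real.coe_toNNReal _ hs.le]
        refine ENNReal.ofReal_le_ofReal ?_
        gcongr
        rw [neg_div, neg_le_neg_iff, sub_zero]
        have hz0 : 0 ≤ z := le_trans (by have : 0 ≤ 1 - δ := by linarith
                                         positivity) hz.1
        have h1 : z ^ 2 ≤ (x * s) ^ 2 := pow_le_pow_left₀ hz0 hz.2 2
        rw [div_le_iff₀ (by positivity)]
        calc z ^ 2 ≤ (x * s) ^ 2 := h1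
          _ = _ := by ring

/-- Over compact intervals the residual is negligible with high probability. -/
theorem IsCenteredGaussian.exists_residual_le (hX : IsCenteredGaussian v X P)
    (hv : IsRegularVariance v)
    (hk : IsFeatureMap v k) (I : Finset ℝ) (a : ℝ → ℝ) (hne : ∑ i ∈ I, a i • k i ≠ 0) {u η : ℝ}
    (hu : u ≤ 0) (hη : 0 < η) :
    ∀ᶠ n : ℕ in atTop, ∀ {Y : ℝ → Ω → ℝ}, IsCenteredGaussian v Y P →
      P {ω | ∃ t ∈ Icc u 0, √n * η < |Y t ω - inner ℝ (k t) (∑ i ∈ I, a i • k i) /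
        ‖∑ i ∈ I, a i • k i‖ ^ 2 * ∑ i ∈ I, a i * Y i ω|} ≤ 1 / 2 := by
  set g := ∑ i ∈ I, a i • k i with hg
  have hpos : 0 < ‖g‖ ^ 2 := by positivity
  obtain ⟨κ, hκ, hosc⟩ := hX.exists_measure_exists_le (h := -u) (by linarith)
  have hkc := hk.continuous hv
  obtain ⟨G, hG⟩ := (isCompact_Icc (a := u) (b := (0 : ℝ))).exists_bound_of_continuousOn
    (f := fun t ↦ inner ℝ (k t) g / ‖g‖ ^ 2)
    ((hkc.inner continuous_const).div_const _).continuousOn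
  have hG0 : 0 ≤ G := (norm_nonneg _).trans (hG u ⟨le_rfl, hu⟩)
  -- Half of `η` goes to `|Y t|`, bounded by two increments from `u`, and half to the projection,
  -- whose coefficient is at most `G`.
  set η' := η / (2 * (G + 1)) with hη'
  have hη'0 : 0 < η' := by positivity
  have hlim (q : ℝ) (hq : 0 < q) :
      Tendsto (fun n : ℕ ↦ ENNReal.ofReal (Real.exp (-(q * n)))) atTop (𝓝 0) := by
    rw [← ENNReal.ofReal_zero]
    refine ENNReal.tendsto_ofReal (Real.tendsto_exp_atBot.comp (tendsto_neg_atTop_atBot.comp ?_))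
    exact tendsto_natCast_atTop_atTop.const_mul_atTop hq
  have hlim2 : Tendsto (fun n : ℕ ↦
      ferniqueConst * ENNReal.ofReal (Real.exp (-(κ * (η / 4) ^ 2 * n))) +
      (ENNReal.ofReal (Real.exp (-(η' ^ 2 / (2 * ‖g‖ ^ 2) * n))) +
        ENNReal.ofReal (Real.exp (-(η' ^ 2 / (2 * ‖g‖ ^ 2) * n))))) atTop
      (𝓝 (ferniqueConst * 0 + (0 + 0))) :=
    (ENNReal.Tendsto.const_mul (hlim _ (by positivity)) (Or.inr ferniqueConst_ne_top)).add
      ((hlim _ (by positivity)).add (hlim _ (by positivity)))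
  rw [mul_zero, add_zero, add_zero] at hlim2
  filter_upwards [hlim2.eventually_lt_const (show (0 : ENNReal) < 1 / 2 by simp)] with n hn Y hY
  have hn0 : (0 : ℝ) ≤ n := n.cast_nonneg
  have hsq : √(n : ℝ) ^ 2 = n := Real.sq_sqrt hn0
  set Z : Ω → ℝ := fun ω ↦ ∑ i ∈ I, a i * Y i ω with hZ
  have hZm : Measurable Z := Finset.measurable_fun_sum _ fun i _ ↦ (hY.measurable i).const_mul _
  have hZneg : P.map (fun ω ↦ -Z ω) = gaussianReal 0 (‖g‖ ^ 2).toNNReal := by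
    have := Measure.map_map (μ := P) measurable_neg hZm
    rw [hY.map_sum_eq hk, gaussianReal_map_neg, neg_zero] at this
    exact this.symm
  refine le_trans ?_ hn.le
  have hsub : {ω | ∃ t ∈ Icc u 0, √n * η < |Y t ω - inner ℝ (k t) g / ‖g‖ ^ 2 * Z ω|} ⊆
      {ω | ∃ r ∈ Icc 0 (-u), √n * (η / 4) < |Y (u + r) ω - Y u ω|} ∪
      ({ω | √n * η' ≤ Z ω} ∪ {ω | √n * η' ≤ -Z ω}) := by
    rintro ω ⟨t, ht, hω⟩
    by_contra hcon
    simp only [mem_union, mem_ofPred_eq, not_or, not_le, not_exists, not_and, not_lt] at hcon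
    obtain ⟨h1, h2, h3⟩ := hcon
    have h4 := h1 (t - u) ⟨by linarith [ht.1], by linarith [ht.2]⟩
    have h5 := h1 (-u) ⟨by linarith, le_rfl⟩
    rw [add_sub_cancel] at h4
    rw [add_neg_cancel, hY.zero, zero_sub, abs_neg] at h5
    have h6 : |Y t ω| ≤ √n * (η / 4) + √n * (η / 4) := by
      calc |Y t ω| = |(Y t ω - Y u ω) + Y u ω| := by ring_nf
        _ ≤ _ := (abs_add_le _ _).trans (add_le_add h4 h5)
    have h7 : |Z ω| ≤ √n * η' := abs_le.2 ⟨by linarith, h2.le⟩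
    have h8 : |inner ℝ (k t) g / ‖g‖ ^ 2 * Z ω| ≤ √n * (η / 2) := by
      rw [abs_mul]
      calc |inner ℝ (k t) g / ‖g‖ ^ 2| * |Z ω| ≤ G * (√n * η') := by
            gcongr
            exact hG t ht
        _ ≤ (G + 1) * (√n * η') := by gcongr; linarith
        _ = √n * (η / 2) := by rw [hη']; field_simp
    have := (abs_sub _ _).trans (add_le_add h6 h8)
    linarith
  refine (measure_mono hsub).trans ((measure_union_le _ _).trans (add_le_add ?_
    ((measure_union_le _ _).trans (add_le_add ?_ ?_))))
  · refine (hosc (hY.shift hv.zero u) _ (by positivity)).trans_eq ?_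
    rw [mul_pow, hsq, mul_comm (n : ℝ), mul_assoc]
  · refine (measure_ge_le_of_map_eq_gaussianReal hZm (hY.map_sum_eq hk I a) hpos ?_
      (by positivity)).trans_eq ?_
    · rw [Real.coe_toNNReal _ hpos.le]
    · rw [mul_pow, hsq, mul_comm (n : ℝ), mul_div_right_comm]
  · refine (measure_ge_le_of_map_eq_gaussianReal hZm.neg hZneg hpos ?_
      (by positivity)).trans_eq ?_
    · rw [Real.coe_toNNReal _ hpos.le]
    · rw [mul_pow, hsq, mul_comm (n : ℝ), mul_div_right_comm]

/-- By independence the probability is at least that of `Z` lying just below `√n ‖g‖²`, times that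
of a small residual, which is at least `1 / 2`; the constant factors are absorbed because `‖g‖² < 2
L`. -/
theorem IsCenteredGaussian.le_measure_overflow (hX : IsCenteredGaussian v X P)
    (hv : IsRegularVariance v) (hk : IsFeatureMap v k) {b c₁ c₂ u L : ℝ} (hb : 0 < b)
    (hc₂ : 0 < c₂) (hu : u < 0) {f : H} (hf : OverflowFrom b c₁ c₂ u fun t ↦ inner ℝ (k t) f)
    (hL : ‖f‖ ^ 2 < 2 * L) :
    ∀ᶠ n : ℕ in atTop, ∀ {Y : ℝ → Ω → ℝ}, IsCenteredGaussian v Y P →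
      ENNReal.ofReal (Real.exp (-(n * L))) ≤
        P {ω | OverflowFrom (√n * b) (√n * c₁) (√n * c₂) u fun t ↦ Y t ω} := by
  obtain ⟨I, a, hgL, hgo⟩ := hk.exists_sum_overflow hv hu.le hf hL
  have hkc := hk.continuous hv
  have hne : ∑ i ∈ I, a i • k i ≠ 0 := by
    intro h0
    have := hgo 0 ⟨hu.le, le_rfl⟩
    simp only [h0, inner_zero_right] at this
    nlinarith
  have hres {η : ℝ} (hη : 0 < η) := hX.exists_residual_le hv hk I a hne hu.le hη
  set g := ∑ i ∈ I, a i • k i with hg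
  have hpos : 0 < ‖g‖ ^ 2 := by positivity
  have hgc : Continuous fun t ↦ inner ℝ (k t) g := hkc.inner continuous_const
  obtain ⟨η, hη, hslack⟩ := hgo.exists_slack hgc hu.le
  obtain ⟨B, hB⟩ := (isCompact_Icc (a := u) (b := (0 : ℝ))).exists_bound_of_continuousOn
    (f := fun t ↦ inner ℝ (k t) g - inner ℝ (k u) g) (by fun_prop)
  have hB0 : 0 ≤ B := (norm_nonneg _).trans (hB u ⟨le_rfl, hu.le⟩)
  -- Deviation of `Z` costs at most `√n η / 4` on increments and the residual `√n η / 4` at each of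
  -- `w` and `u`: in total less than the slack `√n η`.
  set δ := min 1 (η / (4 * (B + 1))) with hδ
  have hδ0 : 0 < δ := lt_min one_pos (by positivity)
  have hδB : δ * B ≤ η / 4 := by
    calc δ * B ≤ η / (4 * (B + 1)) * (B + 1) := by
          gcongr
          · exact min_le_right _ _
          · linarith
      _ = η / 4 := by field_simp
  set q := δ * ‖g‖ ^ 2 / √(2 * Real.pi * ‖g‖ ^ 2) with hq
  have hq0 : 0 < q := by positivity
  have hgrow : Tendsto (fun n : ℕ ↦ Real.exp ((L - ‖g‖ ^ 2 / 2) * n)) atTop atTop :=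
    Real.tendsto_exp_atTop.comp (tendsto_natCast_atTop_atTop.const_mul_atTop (by linarith))
  filter_upwards [hres (show 0 < η / 4 by positivity), hgrow.eventually_ge_atTop (2 / q),
    eventually_ge_atTop 1] with n hn1 hn2 hn Y hY
  have hn1' : (1 : ℝ) ≤ n := by exact_mod_cast hn
  have hs1 : 1 ≤ √(n : ℝ) := Real.one_le_sqrt.2 hn1'
  have hsq : √(n : ℝ) ^ 2 = n := Real.sq_sqrt (by linarith)
  have hR := hn1 hY
  have hind := hY.indepFun_residual hk I a hne
  have hmap := hY.map_sum_eq hk I a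
  rw [← hg] at hind hmap
  set Z : Ω → ℝ := fun ω ↦ ∑ i ∈ I, a i * Y i ω with hZ
  have hZm : Measurable Z := Finset.measurable_fun_sum _ fun i _ ↦ (hY.measurable i).const_mul _
  set R : Ω → ℝ → ℝ := fun ω t ↦ Y t ω - inner ℝ (k t) g / ‖g‖ ^ 2 * Z ω with hRdef
  have hRc (ω) : Continuous (R ω) :=
    (hY.continuous_paths ω).sub ((hgc.div_const _).mul continuous_const)
  have : Nonempty (Icc u 0) := ⟨⟨0, hu.le, le_rfl⟩⟩
  -- Restricting to countably many times makes `S` measurable for the product σ-algebra; continuity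
  -- of the residual recovers all of `[u, 0]`.
  set S : Set (ℝ → ℝ) :=
    ⋂ j, {f | |f (TopologicalSpace.denseSeq (Icc u 0) j)| ≤ √n * (η / 4)} with hS
  have hSm : MeasurableSet S := MeasurableSet.iInter fun j ↦
    measurableSet_le (measurable_pi_apply _).abs measurable_const
  have hSle (ω) (hω : R ω ∈ S) (t) (ht : t ∈ Icc u 0) : |R ω t| ≤ √n * (η / 4) := by
    by_contra! hlt
    have hc : Continuous fun r : Icc u 0 ↦ |R ω r| := ((hRc ω).comp continuous_subtype_val).abs
    obtain ⟨j, hj⟩ := (TopologicalSpace.denseRange_denseSeq (Icc u 0)).exists_mem_open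
      (isOpen_lt continuous_const hc) ⟨⟨t, ht⟩, hlt⟩
    have hle : |R ω (TopologicalSpace.denseSeq (Icc u 0) j)| ≤ √n * (η / 4) := mem_iInter.1 hω j
    exact hle.not_gt hj
  set J : Set ℝ := Icc (√n * (‖g‖ ^ 2 * (1 - δ))) (√n * ‖g‖ ^ 2) with hJ
  have hRS : (1 / 2 : ENNReal) ≤ P (R ⁻¹' S) := by
    have hRm : Measurable R := measurable_pi_iff.2 fun t ↦
      (hY.measurable t).sub (hZm.const_mul _)
    have h1 : P (R ⁻¹' S)ᶜ ≤ 1 / 2 := by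
      refine (measure_mono fun ω hω ↦ ?_).trans hR
      simp only [hS, mem_compl_iff, mem_preimage, mem_iInter, not_forall] at hω
      obtain ⟨j, hj⟩ := hω
      exact ⟨_, Subtype.prop _, not_le.1 hj⟩
    rw [← compl_compl (R ⁻¹' S), prob_compl_eq_one_sub (hRm hSm).compl]
    calc (1 / 2 : ENNReal) = 1 - 1 / 2 := by simp
      _ ≤ _ := by gcongr
  have hZJ : ENNReal.ofReal (q * Real.exp (-(n * (‖g‖ ^ 2 / 2)))) ≤ P (Z ⁻¹' J) := by
    rw [← Measure.map_apply hZm measurableSet_Icc, hmap]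
    have := gaussianReal_Icc_ge hpos hδ0 (min_le_left _ _) hs1
    rwa [hsq] at this
  have hprod : P (Z ⁻¹' J ∩ R ⁻¹' S) = P (Z ⁻¹' J) * P (R ⁻¹' S) :=
    hind.measure_inter_preimage_eq_mul {f : Unit → ℝ | f () ∈ J} S
      (measurable_pi_apply () measurableSet_Icc) hSm
  have hsub : Z ⁻¹' J ∩ R ⁻¹' S ⊆
      {ω | OverflowFrom (√n * b) (√n * c₁) (√n * c₂) u fun t ↦ Y t ω} := by
    rintro ω ⟨hωZ, hωR⟩ w hw
    have h1 := abs_le.1 (hSle ω hωR w hw)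
    have h2 := abs_le.1 (hSle ω hωR u ⟨le_rfl, hu.le⟩)
    have h3 := hslack w hw
    set z := Z ω / ‖g‖ ^ 2 with hz
    have hz1 : √n * (1 - δ) ≤ z := by
      rw [hz, le_div_iff₀ hpos]
      calc _ = √n * (‖g‖ ^ 2 * (1 - δ)) := by ring
        _ ≤ _ := hωZ.1
    have hz2 : z ≤ √n := by
      rw [hz, div_le_iff₀ hpos]
      exact hωZ.2
    have e (t) : Y t ω = inner ℝ (k t) g * z + R ω t := by
      simp only [hRdef, hz]
      ring
    have h4 := hB w hw
    rw [Real.norm_eq_abs] at h4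
    set D := inner ℝ (k w) g - inner ℝ (k u) g with hD
    have h5 : -(√n * (η / 4)) ≤ (z - √n) * D := by
      have : |(z - √n) * D| ≤ √n * δ * B := by
        rw [abs_mul]
        gcongr
        rw [abs_le]
        constructor <;> nlinarith
      have h6 : √(n : ℝ) * δ * B ≤ √n * (η / 4) := by
        rw [mul_assoc]
        gcongr
      linarith [(abs_le.1 this).1]
    have h7 : √n * (b - c₂ * u + c₁ * w + η) ≤ √n * D := by gcongr
    have h8 : 0 < √n * η := by positivity
    change _ < Y w ω - Y u ω
    rw [e w, e u]
    have h9 : inner ℝ (k w) g * z - inner ℝ (k u) g * z = (z - √n) * D + √n * D := by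
      rw [hD]; ring
    linarith
  calc ENNReal.ofReal (Real.exp (-(n * L)))
      ≤ ENNReal.ofReal (q * Real.exp (-(n * (‖g‖ ^ 2 / 2))) * (1 / 2)) := by
        refine ENNReal.ofReal_le_ofReal ?_
        have e1 : Real.exp (-(n * (‖g‖ ^ 2 / 2))) =
            Real.exp ((L - ‖g‖ ^ 2 / 2) * n) * Real.exp (-(n * L)) := by
          rw [← Real.exp_add]; ring_nf
        rw [e1]
        have h1 : 1 ≤ q / 2 * Real.exp ((L - ‖g‖ ^ 2 / 2) * n) := by
          calc (1 : ℝ) = q / 2 * (2 / q) := by field_simp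
            _ ≤ _ := by gcongr
        nlinarith [Real.exp_pos (-(n * L))]
    _ = ENNReal.ofReal (q * Real.exp (-(n * (‖g‖ ^ 2 / 2)))) * (1 / 2) := by
        rw [ENNReal.ofReal_mul (by positivity)]
        simp [ENNReal.ofReal_inv_of_pos]
    _ ≤ P (Z ⁻¹' J) * P (R ⁻¹' S) := by gcongr
    _ = P (Z ⁻¹' J ∩ R ⁻¹' S) := hprod.symm
    _ ≤ _ := measure_mono hsub

end Lower

/-! ### The reproducing kernel Hilbert space as a feature space. -/

section ReproducingKernel

variable {v : ℝ → ℝ} [Fact (covKernel v).PosSemidef]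

theorem inner_kerFun_one (t : ℝ) (f : RKHS.OfKernel (covKernel v)) :
    inner ℝ (RKHS.kerFun (RKHS.OfKernel (covKernel v)) t (1 : ℝ)) f = f t := by
  simp

theorem isFeatureMap_kerFun :
    IsFeatureMap v fun t ↦ RKHS.kerFun (RKHS.OfKernel (covKernel v)) t (1 : ℝ) where
  inner_eq s t := by
    rw [inner_kerFun_one, RKHS.kerFun_apply, RKHS.OfKernel.kernel_ofKernel]
    simp [covKernel]
  dense := by
    refine top_unique ?_
    rw [← RKHS.kerFun_dense (RKHS.OfKernel (covKernel v))]
    refine Submodule.topologicalClosure_mono (Submodule.span_le.2 ?_)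
    rintro _ ⟨t, r, rfl⟩
    have : RKHS.kerFun (RKHS.OfKernel (covKernel v)) t r =
        r • RKHS.kerFun (RKHS.OfKernel (covKernel v)) t (1 : ℝ) := by
      rw [← map_smul, smul_eq_mul, mul_one]
    rw [this]
    exact Submodule.smul_mem _ _ (Submodule.subset_span (mem_range_self t))

end ReproducingKernel

/-- Cauchy–Schwarz gives `|f t| ≤ ‖f‖ √v(|t|)`, of smaller order than `|t|`. -/
theorem IsFeatureMap.inner_mem_pathSpace {H : Type*} [NormedAddCommGroup H]
    [InnerProductSpace ℝ H] {v : ℝ → ℝ} {k : ℝ → H} (hk : IsFeatureMap v k)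
    (hv : IsRegularVariance v) (f : H) : (fun t ↦ inner ℝ (k t) f) ∈ pathSpace := by
  have hsmall {δ : ℝ} (hδ : 0 < δ) :
      ∀ᶠ r in atTop, ∀ t : ℝ, |t| = r → |inner ℝ (k t) f / (1 + |t|)| < δ := by
    filter_upwards [hv.eventually_mul_lt (M := ‖f‖ ^ 2) (c := δ ^ 2) (by positivity)
      (by positivity), eventually_gt_atTop 0] with r hr hr0 t ht
    have h1 : |inner ℝ (k t) f| ≤ ‖k t‖ * ‖f‖ := abs_real_inner_le_norm _ _
    have h2 : (‖k t‖ * ‖f‖) ^ 2 < (δ * r) ^ 2 := by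
      rw [mul_pow, hk.norm_sq hv, ht]
      nlinarith
    have h3 : ‖k t‖ * ‖f‖ < δ * r := lt_of_pow_lt_pow_left₀ 2 (by positivity) h2
    rw [abs_div, abs_of_pos (show 0 < 1 + |t| by positivity), div_lt_iff₀ (by positivity), ht]
    nlinarith
  refine ⟨(hk.continuous hv).inner continuous_const, ?_, ?_, ?_⟩
  · simp [hk.zero hv]
  · rw [Metric.tendsto_nhds]
    intro δ hδ
    filter_upwards [tendsto_abs_atTop_atTop.eventually (hsmall hδ)] with t ht
    simpa only [dist_zero_right, Real.norm_eq_abs] using ht t rfl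
  · rw [Metric.tendsto_nhds]
    intro δ hδ
    filter_upwards [tendsto_abs_atBot_atTop.eventually (hsmall hδ)] with t ht
    simpa only [dist_zero_right, Real.norm_eq_abs] using ht t rfl

theorem overflowFrom_mul_iff {a b c₁ c₂ u : ℝ} (ha : 0 < a) {f : ℝ → ℝ} :
    OverflowFrom (a * b) (a * c₁) (a * c₂) u (fun t ↦ a * f t) ↔ OverflowFrom b c₁ c₂ u f := by
  refine forall₂_congr fun w _ ↦ ?_
  rw [← mul_lt_mul_iff_right₀ ha (b := b - c₂ * u + c₁ * w)]
  ring_nf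

/-! ### Passage from the queue to the normalised Gaussian process. -/

section Sources

variable {Ω : Type*} [MeasurableSpace Ω] {P : Measure Ω} [IsProbabilityMeasure P] {v : ℝ → ℝ}

/-- The case `n = 1` of the tail bound gives probability at most `exp(-K)` for every `K`. This
supplies the bound that makes the suprema of the queues genuine. -/
theorem IsCenteredGaussian.ae_lower_bound {Y : ℝ → Ω → ℝ} (hY : IsCenteredGaussian v Y P)
    (hv : IsRegularVariance v) {c : ℝ} (hc : 0 < c) :
    ∀ᵐ ω ∂P, ∃ C, ∀ u ≤ 0, c * u - C ≤ Y u ω := by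
  have hnull : P {ω | ∀ T > 0, ∃ u ≤ -T, Y u ω < c * u} = 0 := by
    have hle (K : ℕ) : P {ω | ∀ T > 0, ∃ u ≤ -T, Y u ω < c * u} ≤
        ENNReal.ofReal (Real.exp (-K)) := by
      obtain ⟨T, hT, h⟩ := hY.exists_tail hv hc (K : ℝ)
      have h1 := h hY 1 one_ne_zero
      simp only [Nat.cast_one, Real.sqrt_one, one_mul] at h1
      refine le_trans (measure_mono fun ω hω ↦ ?_) h1
      exact hω T hT
    have hlim : Tendsto (fun K : ℕ ↦ ENNReal.ofReal (Real.exp (-K))) atTop (𝓝 0) := by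
      rw [← ENNReal.ofReal_zero]
      exact ENNReal.tendsto_ofReal
        (Real.tendsto_exp_neg_atTop_nhds_zero.comp tendsto_natCast_atTop_atTop)
    exact le_antisymm (ge_of_tendsto' hlim hle) zero_le
  have hae : ∀ᵐ ω ∂P, ¬ ∀ T > 0, ∃ u ≤ -T, Y u ω < c * u := by
    rw [ae_iff]
    simpa only [not_not] using hnull
  filter_upwards [hae] with ω hω
  push Not at hω
  obtain ⟨T, hT, h⟩ := hω
  obtain ⟨B, hB⟩ := (isCompact_Icc (a := -T) (b := (0 : ℝ))).exists_bound_of_continuousOn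
    (hY.continuous_paths ω).continuousOn
  refine ⟨max B 0, fun u hu ↦ ?_⟩
  rcases le_total u (-T) with hu' | hu'
  · linarith [h u hu', le_max_right B 0]
  · have := neg_le_of_abs_le (hB u ⟨hu', hu⟩)
    nlinarith [le_max_left B 0]

theorem ae_lt_secondQueue_iff {A : ℕ → ℝ → Ω → ℝ} {n : ℕ} (hn : n ≠ 0)
    (hY : IsCenteredGaussian v (fun t ω ↦ (√n)⁻¹ * ∑ i ∈ Finset.range n, A i t ω) P)
    (hv : IsRegularVariance v) {b c₁ c₂ : ℝ} (hb : 0 < b) (hc₂ : 0 < c₂) (hc : c₂ < c₁) :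
    ∀ᵐ ω ∂P, n * b <
        secondQueue (fun t ↦ ∑ i ∈ Finset.range n, A i t ω) (n * c₁) (n * c₂) 0 ↔
      ∃ u < 0, OverflowFrom (√n * b) (√n * c₁) (√n * c₂) u
        fun t ↦ (√n)⁻¹ * ∑ i ∈ Finset.range n, A i t ω := by
  have hn0 : (0 : ℝ) < n := by exact_mod_cast Nat.pos_of_ne_zero hn
  have hs0 : 0 < √(n : ℝ) := Real.sqrt_pos.2 hn0
  have hsq (x : ℝ) : √(n : ℝ) * (√n * x) = n * x := by
    rw [← mul_assoc, Real.mul_self_sqrt hn0.le]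
  filter_upwards [hY.ae_lower_bound hv (show 0 < √n * c₂ by positivity)] with ω ⟨C, hC⟩
  set y : ℝ → ℝ := fun t ↦ (√n)⁻¹ * ∑ i ∈ Finset.range n, A i t ω with hy
  have hxy : (fun t ↦ ∑ i ∈ Finset.range n, A i t ω) = fun t ↦ √n * y t := by
    funext t
    rw [hy, mul_inv_cancel_left₀ hs0.ne']
  have hyc : Continuous y := hY.continuous_paths ω
  have hy0 : y 0 = 0 := hY.zero ω
  have hlow : ∀ u ≤ 0, n * c₂ * u - √n * C ≤ √n * y u := fun u hu ↦ by
    have := mul_le_mul_of_nonneg_left (hC u hu) hs0.le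
    rw [mul_sub, mul_assoc, hsq] at this
    linarith
  rw [hxy]
  constructor
  · intro h
    obtain ⟨u, hu, ho⟩ := exists_overflowFrom_of_lt_secondQueue (hyc.const_mul _)
      (by gcongr) hlow h
    refine ⟨u, hu, ?_⟩
    rw [← hsq, ← hsq, ← hsq] at ho
    exact (overflowFrom_mul_iff hs0).1 ho
  · rintro ⟨u, hu, ho⟩
    have := (overflowFrom_mul_iff hs0).2 ho
    rw [hsq, hsq, hsq] at this
    exact lt_secondQueue_of_overflowFrom (hyc.const_mul _) (by simp [hy0]) (by positivity)
      (by gcongr) hlow hu this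

end Sources

/-! ### Existence of the decay rate and the final inequality. -/

/-- The decay rate of the overflow probability, as an infimum over a reproducing kernel Hilbert
space with feature map `k`. -/
noncomputable def decayRate {H : Type*} [NormedAddCommGroup H] [InnerProductSpace ℝ H]
    (k : ℝ → H) (b c₁ c₂ : ℝ) : EReal :=
  ⨅ (f : H) (_ : ∃ u < 0, OverflowFrom b c₁ c₂ u fun t ↦ inner ℝ (k t) f),
    ((‖f‖ ^ 2 / 2 : ℝ) : EReal)

theorem tendsto_neg_log_div {p : ℕ → ENNReal} {J : EReal}
    (hup : ∀ L : ℝ, (L : EReal) < J →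
      ∃ C ≠ ⊤, ∀ᶠ n : ℕ in atTop, p n ≤ C * ENNReal.ofReal (Real.exp (-(n * L))))
    (hlow : ∀ L : ℝ, J < L → ∀ᶠ n : ℕ in atTop, ENNReal.ofReal (Real.exp (-(n * L))) ≤ p n) :
    Tendsto (fun n : ℕ ↦ -(ENNReal.log (p n) / (n : EReal))) atTop (𝓝 J) := by
  have hlog (n : ℕ) (L : ℝ) :
      ENNReal.log (ENNReal.ofReal (Real.exp (-(n * L)))) = ((-(n * L) : ℝ) : EReal) := by
    rw [ENNReal.log_ofReal_of_pos (Real.exp_pos _), Real.log_exp]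
  have hdiv {n : ℕ} (hn : n ≠ 0) (L : ℝ) :
      -(((-(n * L) : ℝ) : EReal) / (n : EReal)) = L := by
    have hn0 : (n : ℝ) ≠ 0 := by exact_mod_cast hn
    rw [show (n : EReal) = ((n : ℝ) : EReal) from rfl, ← EReal.coe_div, ← EReal.coe_neg]
    congr 1
    field_simp
  refine tendsto_order.2 ⟨fun a ha ↦ ?_, fun a ha ↦ ?_⟩
  · obtain ⟨L, haL, hLJ⟩ := EReal.lt_iff_exists_real_btwn.1 ha
    -- The room between `L` and `L'` absorbs the constant `C`, since `exp((L' - L) n)` eventually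
    -- exceeds it.
    obtain ⟨L', hLL', hL'J⟩ := EReal.lt_iff_exists_real_btwn.1 hLJ
    rw [EReal.coe_lt_coe_iff] at hLL'
    obtain ⟨C, hC, hev⟩ := hup L' hL'J
    have hlim : Tendsto (fun n : ℕ ↦ Real.exp ((L' - L) * n)) atTop atTop :=
      Real.tendsto_exp_atTop.comp (tendsto_natCast_atTop_atTop.const_mul_atTop (by linarith))
    filter_upwards [hev, hlim.eventually_ge_atTop C.toReal, eventually_ne_atTop 0] with n h1 h2 h3
    refine haL.trans_le ?_
    have h4 : p n ≤ ENNReal.ofReal (Real.exp (-(n * L))) := by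
      refine h1.trans ?_
      have e : Real.exp (-(n * L)) = Real.exp ((L' - L) * n) * Real.exp (-(n * L')) := by
        rw [← Real.exp_add]; ring_nf
      rw [e, ENNReal.ofReal_mul (Real.exp_pos _).le]
      gcongr
      exact ENNReal.le_ofReal_iff_toReal_le hC (Real.exp_pos _).le |>.2 h2
    rw [← hdiv h3 L, EReal.neg_le_neg_iff, ← hlog]
    exact EReal.div_le_div_right_of_nonneg (EReal.coe_nonneg.2 n.cast_nonneg) (ENNReal.log_le_log h4)
  · obtain ⟨L, hJL, hLa⟩ := EReal.lt_iff_exists_real_btwn.1 ha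
    filter_upwards [hlow L hJL, eventually_ne_atTop 0] with n h1 h2
    refine lt_of_le_of_lt ?_ hLa
    rw [← hdiv h2 L, EReal.neg_le_neg_iff, ← hlog]
    exact EReal.div_le_div_right_of_nonneg (EReal.coe_nonneg.2 n.cast_nonneg) (ENNReal.log_le_log h1)

theorem IsGaussianSource.tendsto_secondQueue {Ω : Type*} [MeasurableSpace Ω] {P : Measure Ω}
    [IsProbabilityMeasure P] {v : ℝ → ℝ} {A : ℕ → ℝ → Ω → ℝ}
    (hA : ∀ i, IsGaussianSource v (A i) P) (hindep : iIndepFun (fun i ω t ↦ A i t ω) P)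
    (hv : ∃ α : ℝ, α < 2 ∧ Tendsto (fun t : ℝ ↦ v t / t ^ α) atTop (𝓝 0))
    {H : Type*} [NormedAddCommGroup H] [InnerProductSpace ℝ H] [CompleteSpace H] {k : ℝ → H}
    (hk : IsFeatureMap v k) {b c₁ c₂ : ℝ} (hb : 0 < b) (hc₂ : 0 < c₂) (hc : c₂ < c₁) :
    Tendsto (fun n : ℕ ↦ -(ENNReal.log (P {ω | n * b <
      secondQueue (fun t ↦ ∑ i ∈ Finset.range n, A i t ω) (n * c₁) (n * c₂) 0}) / (n : EReal)))
      atTop (𝓝 (decayRate k b c₁ c₂)) := by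
  have hreg := (hA 0).isRegularVariance hv
  have hG (i) := (hA i).isCenteredGaussian
  have hY {n : ℕ} (hn : n ≠ 0) := IsCenteredGaussian.normalised_sum hG hindep hn
  have hP {n : ℕ} (hn : n ≠ 0) := measure_congr
    (ae_lt_secondQueue_iff hn (hY hn) hreg hb hc₂ hc).set_eq
  refine tendsto_neg_log_div (fun L hL ↦ ?_) (fun L hL ↦ ?_)
  · obtain ⟨L', hLL', hL'⟩ := EReal.lt_iff_exists_real_btwn.1 hL
    obtain ⟨ε, hε, hgap⟩ := hk.exists_gap hreg hb hc₂ hc (J := L') (L := L) (fun f hf ↦ by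
      have := hL'.le.trans (iInf₂_le f hf)
      rw [EReal.coe_le_coe_iff] at this
      linarith) (EReal.coe_lt_coe_iff.1 hLL')
    obtain ⟨C, hC, h⟩ := (hG 0).measure_overflow_le hreg hk hb hc₂ hc hε hgap
    refine ⟨C, hC, ?_⟩
    filter_upwards [eventually_ne_atTop 0] with n hn
    exact (hP hn).trans_le (h (hY hn) n hn)
  · rw [decayRate, iInf_lt_iff] at hL
    obtain ⟨f, hf⟩ := hL
    obtain ⟨⟨u, hu, ho⟩, hf⟩ := iInf_lt_iff.1 hf
    rw [EReal.coe_lt_coe_iff] at hf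
    filter_upwards [(hG 0).le_measure_overflow hreg hk hb hc₂ hu ho (L := L) (by linarith),
      eventually_ne_atTop 0] with n h hn
    refine ((h (hY hn)).trans (measure_mono fun ω hω ↦ ?_)).trans_eq (hP hn).symm
    exact ⟨u, hu, hω⟩

theorem OverflowFrom.lt_neg {b c₁ c₂ u : ℝ} {f : ℝ → ℝ} (h : OverflowFrom b c₁ c₂ u f)
    (hu : u < 0) (hc : c₂ < c₁) : b / (c₁ - c₂) < -u := by
  have := h u ⟨le_rfl, hu.le⟩
  rw [div_lt_iff₀ (by linarith)]
  linarith

theorem OverflowFrom.mem_pathsU {b c₁ c₂ u s : ℝ} {f : ℝ → ℝ} (h : OverflowFrom b c₁ c₂ u f)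
    (hf : f ∈ pathSpace) (hs : s ∈ Ioo 0 (-u)) : f ∈ pathsU b c₁ c₂ s (-u) := by
  have h1 := h 0 ⟨by linarith [hs.1, hs.2], le_rfl⟩
  have h2 := h (-s) ⟨by linarith [hs.2], by linarith [hs.1]⟩
  rw [hf.2.1] at h1
  rw [pathsU, mem_ofPred_eq, neg_neg]
  exact ⟨hf, by linarith, by linarith⟩

theorem rateFunction_coe_le {K : Matrix ℝ ℝ (ℝ →L[ℝ] ℝ)} [hK : Fact K.PosSemidef]
    (g : RKHS.OfKernel K) : rateFunction K hK.out g ≤ ((‖g‖ ^ 2 / 2 : ℝ) : EReal) :=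
  iInf₂_le (f := fun (g' : RKHS.OfKernel K) (_ : (g' : ℝ → ℝ) = g) ↦
    ((‖g'‖ ^ 2 / 2 : ℝ) : EReal)) g rfl

end TandemQueue

theorem theorem3p2 {Ω : Type*} [MeasurableSpace Ω] (P : Measure Ω) [IsProbabilityMeasure P]
    (v : ℝ → ℝ) (A : ℕ → ℝ → Ω → ℝ)
    (hA : ∀ i, TandemQueue.IsGaussianSource v (A i) P)
    (hindep : iIndepFun (fun i ω t ↦ A i t ω) P)
    (hv : ∃ α : ℝ, α < 2 ∧ Tendsto (fun t : ℝ ↦ v t / t ^ α) atTop (𝓝 0))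
    (b c₁ c₂ : ℝ) (hb : 0 < b) (hc₂ : 0 < c₂) (hc : c₂ < c₁) :
    ∃ J : EReal,
      Tendsto (fun n : ℕ ↦ -(ENNReal.log (P {ω | n * b <
          TandemQueue.secondQueue (fun t ↦ ∑ i ∈ Finset.range n, A i t ω) (n * c₁) (n * c₂) 0})
            / (n : EReal))) atTop (𝓝 J) ∧
      J ≥ ⨅ t ∈ Ioi (b / (c₁ - c₂)), ⨆ s ∈ Ioo 0 t, ⨅ f ∈ TandemQueue.pathsU b c₁ c₂ s t,
        TandemQueue.rateFunction (TandemQueue.covKernel v) (hA 0).posSemidef f := by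
  have : Fact (TandemQueue.covKernel v).PosSemidef := ⟨(hA 0).posSemidef⟩
  have hk := TandemQueue.isFeatureMap_kerFun (v := v)
  have hreg := (hA 0).isRegularVariance hv
  refine ⟨_, TandemQueue.IsGaussianSource.tendsto_secondQueue hA hindep hv hk hb hc₂ hc, ?_⟩
  refine le_iInf₂ fun f ⟨u, hu, ho⟩ ↦ ?_
  have hfp := hk.inner_mem_pathSpace hreg f
  simp only [TandemQueue.inner_kerFun_one] at ho hfp
  -- Take `t = -u`; the same `f` competes in the inner infimum for every `s`.
  refine (iInf₂_le (-u) (ho.lt_neg hu hc)).trans (iSup₂_le fun s hs ↦ ?_)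
  exact (iInf₂_le _ (ho.mem_pathsU hfp hs)).trans (TandemQueue.rateFunction_coe_le f)
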